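/- Let $G$ be a finite group and let $\pi$ be a set of primes. For a finite group $X$, write $\mathrm{Irr}(X)$ for the set of irreducible complex characters of $X$, $\mathrm{Lin}(X)=\{\chi\in\mathrm{Irr}(X):\chi(1)=1\}$ for the set of linear characters, $\mathrm{Irr}_{\pi'}(X)$ for the set of those $\chi\in\mathrm{Irr}(X)$ whose degree $\chi(1)$ is not divisible by any prime in $\pi$, $X'$ for the derived subgroup of $X$, and $1_X$ for the principal (constant $1$) character of $X$. Let $M$ be the solvable residual of $G$, that is, the smallest normal subgroup of $G$ such that $G/M$ is solvable, and let $M\le H\le G$ be such that $H/M$ is a Hall $\pi$-subgroup of $G/M$ (every prime dividing $|H/M|$ lies in $\pi$ and no prime in $\pi$ divides $|G:H|$). Then $\mathrm{Irr}_{\pi'}(G)=\mathrm{Lin}(G)$ if and only if both of the following hold: (a) $\mathbf N_{G/M}(H/M)\cap G'/M=H'/M$; (b) the only character in $\mathrm{Irr}_{\pi'}(M)$ that is fixed by the conjugation action of $H$ is $1_M$; that is, $\{\theta\in\mathrm{Irr}_{\pi'}(M):\theta(hmh^{-1})=\theta(m)\text{ for all }h\in H,\ m\in M\}=\{1_M\}$.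 -/

import Mathlib

namespace PiPrimeChar

/-- `Irr(G)`: the set of characters of the irreducible complex representations of `G`.
Every finite-dimensional complex representation is isomorphic to one on some `ℂⁿ`, so it is
enough to let the representation space range over the spaces `Fin n → ℂ`. -/
def Irr (G : Type*) [Group G] : Set (G → ℂ) :=
  {χ | ∃ (n : ℕ) (ρ : Representation ℂ G (Fin n → ℂ)), ρ.IsIrreducible ∧ χ = ρ.character}

/-- `Lin(G)`: the linear characters, that is, the irreducible characters of degree one. -/
def Lin (G : Type*) [Group G] : Set (G → ℂ) :=
  {χ ∈ Irr G | χ 1 = 1}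

/-- `Irr_{π'}(G)`: the irreducible characters whose degree is divisible by no prime in `π`. -/
def IrrPrime (π : Set ℕ) (G : Type*) [Group G] : Set (G → ℂ) :=
  {χ ∈ Irr G | ∃ d : ℕ, χ 1 = (d : ℂ) ∧ ∀ p ∈ π, ¬ p ∣ d}

/-- The character `θ` of the normal subgroup `N` of `G` is fixed by the conjugation action of
`H`: `θ (h n h⁻¹) = θ n` for all `h ∈ H` and `n ∈ N`. -/
def FixedBy {G : Type*} [Group G] (H N : Subgroup G) [N.Normal] (θ : N → ℂ) : Prop :=
  ∀ h ∈ H, ∀ n : N, θ (MulAut.conjNormal h n) = θ n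

/-- `K` is a Hall `π`-subgroup of `G`: every prime dividing the order of `K` lies in `π`, and no
prime dividing the index of `K` lies in `π`. -/
def IsHall {G : Type*} [Group G] (π : Set ℕ) (K : Subgroup G) : Prop :=
  (∀ p : ℕ, p.Prime → p ∣ Nat.card K → p ∈ π) ∧
    ∀ p : ℕ, p.Prime → p ∣ K.index → p ∉ π

/-- The solvable residual of `G`: the intersection of all normal subgroups with solvable quotient.
For finite `G` it is the smallest such subgroup, see `isLeast_solvableResidual`. -/
def solvableResidual (G : Type*) [Group G] : Subgroup G :=
  sInf {N : Subgroup G | ∃ _ : N.Normal, Group.IsSolvable (G ⧸ N)}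

instance solvableResidual_normal (G : Type*) [Group G] : (solvableResidual G).Normal := by
  refine ⟨fun n hn g => ?_⟩
  simp only [solvableResidual, Subgroup.mem_sInf] at hn ⊢
  exact fun N hN => hN.1.conj_mem n (hn N hN) g

/-- For finite `G` the solvable residual is the smallest normal subgroup with solvable quotient. -/
theorem isLeast_solvableResidual (G : Type*) [Group G] [Finite G] :
    IsLeast {N : Subgroup G | ∃ _ : N.Normal, Group.IsSolvable (G ⧸ N)} (solvableResidual G) := by
  refine ⟨?_, fun N hN => sInf_le hN⟩
  have key : ∀ S : Set (Subgroup G), S.Finite →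
      (∀ N ∈ S, ∃ _ : N.Normal, Group.IsSolvable (G ⧸ N)) →
        ∃ _ : (sInf S).Normal, Group.IsSolvable (G ⧸ sInf S) := by
    intro S hS
    induction S, hS using Set.Finite.induction_on with
    | empty =>
      intro _
      rw [sInf_empty]
      have : Subsingleton (G ⧸ (⊤ : Subgroup G)) := QuotientGroup.subsingleton_quotient_top
      exact ⟨inferInstance, inferInstance⟩
    | @insert A S _ _ ih =>
      intro h
      obtain ⟨hB, hB'⟩ := ih fun N hN => h N (Set.mem_insert_of_mem _ hN)
      obtain ⟨hA, hA'⟩ := h A (Set.mem_insert _ _)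
      rw [sInf_insert]
      let f : G →* (G ⧸ A) × (G ⧸ sInf S) :=
        (QuotientGroup.mk' A).prod (QuotientGroup.mk' (sInf S))
      have hf : f.ker = A ⊓ sInf S := by
        simp [f, MonoidHom.ker_prod]
      have h1 : Group.IsSolvable (G ⧸ f.ker) :=
        Group.isSolvable_of_isSolvable_injective (f := QuotientGroup.kerLift f)
          (QuotientGroup.kerLift_injective f)
      rw [← hf]
      exact ⟨inferInstance, h1⟩
  exact key _ (Set.toFinite _) fun N hN => hN

end PiPrimeChar

/-!
Throughout, `M` is a normal subgroup of `G` with solvable quotient and `H ⧸ M` is a Hall `π`-subgroup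
of `G ⧸ M` (`IsHallModulo`). Between `M` and `G` there is a chain of normal subgroups with elementary
abelian factors `K ⧸ N`, and for each factor, of exponent `p` say, one of two things happens. If
`p ∈ π` then `K ≤ N ⊔ H`; if `p ∉ π` then the action of `H` on `K ⧸ N` is coprime, the subgroup
`M` acting trivially on everything of interest. Both directions follow this chain.

If every irreducible character of `G` of `π'`-degree is linear, then `H`-invariant irreducible
characters of `π'`-degree are pushed up the chain. For `p ∉ π`, Glauberman's fixed point lemma
(`exists_smul_fixed`) finds an `H`-invariant character over a given one, and its degree only acquires
factors `p` (`exists_fixedBy_over`, `dvd_degree_of_dvd_degree`). For `p ∈ π` the given character is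
twisted by a power of its determinant until the determinant has order prime to `p`; the twisted
character has a canonical extension, which is again `H`-invariant (`exists_fixedBy_degree_eq`). At the
top the degree is one, hence it was one at the bottom (`apply_one_eq_one_of_fixedBy`), and the perfect
group `M` has no nontrivial linear characters, which is (b). In the same way, a linear character of
`H` trivial on `M`, or an `H`-invariant linear character of some `K` which is trivial on `K ⊓ H`,
extends to a linear character of `G` (`exists_common_extension`). The first kind separates the
elements of `H` from `H'` and the second kind separates the elements of `N_G(H)` from `H`, while all
linear characters of `G` are trivial on `G'`; so `N_G(H) ⊓ G' ≤ H'`, which is (a).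

Conversely, let `χ` be an irreducible character of `π'`-degree. Its restriction to any `N ≥ M` has an
`H`-invariant constituent, because the stabilizer of a constituent has `π'`-index and thus contains a
conjugate of `H` (`exists_fixedBy_conj`). By (b) the kernel of `χ` contains `M`. Suppose that it
contains `N` and let `K ⧸ N` be a factor with `K ≤ G'`. An `H`-invariant constituent `ν` of the
restriction to `K` is linear, and (a) forces `ν = 1`. For `p ∉ π`, otherwise a nontrivial coset of `N`
on which `ν ≠ 1` would be fixed by `H` and, by conjugacy of Hall subgroups in `N ⊔ H`, contain an
element of `N_G(H) ⊓ G'` (`linear_eq_one_of_notMem`). For `p ∈ π`, the determinant of `H` on the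
`ν`-eigenspace, whose dimension is prime to `p`, is trivial on `H ⊓ K ≤ N_G(H) ⊓ G' ≤ H'`
(`linear_eq_one_of_mem`). So the kernel contains `K`, eventually it contains `G'`, and `χ` is linear.
-/

namespace PiPrimeChar

open Representation
open scoped commutatorElement

/-! ### Complex representations and their characters -/

section Representations

variable {G : Type*} [Group G] {V W : Type*} [AddCommGroup V] [Module ℂ V]
  [AddCommGroup W] [Module ℂ W]

theorem isIrreducible_iff (ρ : Representation ℂ G V) :
    ρ.IsIrreducible ↔ Nontrivial V ∧
      ∀ U : Submodule ℂ V, (∀ g, ∀ v ∈ U, ρ g v ∈ U) → U = ⊥ ∨ U = ⊤ := by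
  constructor
  · intro h
    refine ⟨?_, fun U hU => ?_⟩
    · obtain ⟨A, B, hAB⟩ := h.toNontrivial
      by_contra hV
      rw [not_nontrivial_iff_subsingleton] at hV
      exact hAB (Subrepresentation.toSubmodule_injective (Subsingleton.elim _ _))
    · rcases h.eq_bot_or_eq_top (⟨U, fun g v hv => hU g v hv⟩ : Subrepresentation ρ) with h | h
      · exact Or.inl (congrArg Subrepresentation.toSubmodule h)
      · exact Or.inr (congrArg Subrepresentation.toSubmodule h)
  · rintro ⟨hV, h⟩
    have : Nontrivial (Subrepresentation ρ) := by
      refine ⟨⊥, ⊤, fun e => ?_⟩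
      exact bot_ne_top (α := Submodule ℂ V) (congrArg Subrepresentation.toSubmodule e)
    refine ⟨fun A => ?_⟩
    rcases h A.toSubmodule (fun g v hv => A.apply_mem_toSubmodule g hv) with h | h
    · exact Or.inl (Subrepresentation.toSubmodule_injective h)
    · exact Or.inr (Subrepresentation.toSubmodule_injective h)

theorem isIrreducible_of_equiv {ρ : Representation ℂ G V} {σ : Representation ℂ G W}
    (e : ρ.Equiv σ) (h : ρ.IsIrreducible) : σ.IsIrreducible := by
  rw [isIrreducible_iff] at h ⊢
  obtain ⟨hV, h⟩ := h
  refine ⟨e.symm.toLinearEquiv.toEquiv.nontrivial, fun U hU => ?_⟩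
  have key : ∀ g v, e (ρ g v) = σ g (e v) := fun g v =>
    IntertwiningMap.isIntertwining _ _ e.toIntertwiningMap g v
  rcases h (U.comap e.toLinearEquiv.toLinearMap) (fun g v hv => by
    have := hU g _ hv
    show e (ρ g v) ∈ U
    rw [key]; exact this) with h | h
  · left
    rw [eq_bot_iff] at h ⊢
    intro u hu
    have : e.symm u ∈ U.comap e.toLinearEquiv.toLinearMap := by
      show e (e.symm u) ∈ U
      simpa using hu
    have h0 : e.symm u = 0 := h this
    have := congrArg e h0
    simpa using this
  · right
    rw [eq_top_iff] at h ⊢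
    intro u _
    have h1 : e.symm u ∈ U.comap e.toLinearEquiv.toLinearMap := h trivial
    have : e (e.symm u) ∈ U := h1
    simpa using this

/-- Every finite-dimensional complex representation is isomorphic to one on a space `ℂⁿ`. -/
theorem exists_equiv_fin [FiniteDimensional ℂ V] (ρ : Representation ℂ G V) :
    ∃ (n : ℕ) (σ : Representation ℂ G (Fin n → ℂ)), Nonempty (ρ.Equiv σ) := by
  let b := (Module.finBasis ℂ V).equivFun
  refine ⟨Module.finrank ℂ V, (b.conjAlgEquiv ℂ : _ →* _).comp ρ, ⟨.mk b fun g => ?_⟩⟩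
  ext v
  simp [LinearEquiv.conjAlgEquiv_apply]

theorem character_mem_irr [FiniteDimensional ℂ V] {ρ : Representation ℂ G V}
    (h : ρ.IsIrreducible) : ρ.character ∈ Irr G := by
  obtain ⟨n, σ, ⟨e⟩⟩ := exists_equiv_fin ρ
  exact ⟨n, σ, isIrreducible_of_equiv e h, char_iso e⟩

/-- The character of a finite-dimensional representation of a finite group is a sum of irreducible
characters. -/
theorem character_mem_closure [Finite G] [FiniteDimensional ℂ V] (ρ : Representation ℂ G V) :
    ρ.character ∈ AddSubmonoid.closure (Irr G) := by
  induction hd : Module.finrank ℂ V using Nat.strong_induction_on generalizing V with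
  | _ d ih =>
  subst hd
  by_cases hirr : ρ.IsIrreducible
  · exact AddSubmonoid.subset_closure (character_mem_irr hirr)
  rcases subsingleton_or_nontrivial V with hV | hV
  · have : ρ.character = 0 := by
      ext g
      have : ρ g = 0 := LinearMap.ext fun v => Subsingleton.elim _ _
      simp [character, this]
    rw [this]
    exact zero_mem _
  have : ∃ U : Submodule ℂ V, (∀ g, ∀ v ∈ U, ρ g v ∈ U) ∧ U ≠ ⊥ ∧ U ≠ ⊤ := by
    by_contra! hcon
    exact hirr ((isIrreducible_iff ρ).2 ⟨hV, fun U hU => by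
      by_contra! hc
      exact hc.2 (hcon U hU hc.1)⟩)
  obtain ⟨U, hU, hbot, htop⟩ := this
  have : NeZero (Nat.card G : ℂ) := ⟨Nat.cast_ne_zero.2 Nat.card_pos.ne'⟩
  obtain ⟨A, hA⟩ := exists_isCompl (⟨U, fun g v hv => hU g v hv⟩ : Subrepresentation ρ)
  have hc : IsCompl U A.toSubmodule := by
    refine ⟨?_, ?_⟩
    · have := congrArg Subrepresentation.toSubmodule hA.inf_eq_bot
      exact disjoint_iff.2 this
    · have := congrArg Subrepresentation.toSubmodule hA.sup_eq_top
      exact codisjoint_iff.2 this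
  let ρ₁ := (⟨U, fun g v hv => hU g v hv⟩ : Subrepresentation ρ).toRepresentation
  let ρ₂ := A.toRepresentation
  have hsum : ρ.character = ρ₁.character + ρ₂.character := by
    ext g
    have := LinearMap.trace_eq_sum_trace_restrict
      (N := fun b : Bool => cond b U A.toSubmodule)
      ((DirectSum.isInternal_submodule_iff_isCompl _ (i := true) (j := false) (by simp)
        (by ext b; cases b <;> simp)).2 hc) (f := ρ g)
      (fun b => by
        cases b
        · exact fun v hv => A.apply_mem_toSubmodule g hv
        · exact fun v hv => hU g v hv)
    rw [character, this]
    simp only [Fintype.sum_bool]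
    rfl
  rw [hsum]
  have hadd := Submodule.finrank_add_eq_of_isCompl hc
  have h1 : 0 < Module.finrank ℂ U := by
    have := (Submodule.nontrivial_iff_ne_bot).2 hbot
    exact Module.finrank_pos
  have h2 := Submodule.finrank_lt htop
  have h3 : 0 < Module.finrank ℂ A.toSubmodule := by omega
  exact add_mem (ih _ h2 ρ₁ rfl) (ih _ (by omega) ρ₂ rfl)

/-- A nonzero intertwining map between irreducible representations identifies them. -/
theorem exists_equiv_of_ne_zero {ρ : Representation ℂ G V} {σ : Representation ℂ G W}
    (hρ : ρ.IsIrreducible) (hσ : σ.IsIrreducible) (f : V →ₗ[ℂ] W)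
    (hf : ∀ g v, f (ρ g v) = σ g (f v)) (h0 : f ≠ 0) : Nonempty (ρ.Equiv σ) := by
  let F : IntertwiningMap ρ σ := ⟨f, fun g => LinearMap.ext fun v => hf g v⟩
  rcases IsIrreducible.bijective_or_eq_zero F with h | h
  · exact ⟨F.ofBijective h⟩
  · exact absurd (congrArg IntertwiningMap.toLinearMap h) h0

/-- Schur's lemma: an endomorphism commuting with an irreducible representation is a scalar. -/
theorem exists_smul_of_commute [FiniteDimensional ℂ V] {ρ : Representation ℂ G V}
    (hρ : ρ.IsIrreducible) (f : V →ₗ[ℂ] V) (hf : ∀ g v, f (ρ g v) = ρ g (f v)) :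
    ∃ z : ℂ, f = z • LinearMap.id := by
  let F : IntertwiningMap ρ ρ := ⟨f, fun g => LinearMap.ext fun v => hf g v⟩
  obtain ⟨z, hz⟩ := (IsIrreducible.algebraMap_intertwiningMap_bijective_of_isAlgClosed (ρ := ρ)).2 F
  refine ⟨z, ?_⟩
  have := congrArg IntertwiningMap.toLinearMap hz
  exact this.symm

/-- The representation `n ↦ ρ (i n)` obtained by restriction along a homomorphism. -/
abbrev pullback {N : Type*} [Group N] (i : N →* G) (ρ : Representation ℂ G V) :
    Representation ℂ N V :=
  MonoidHom.comp ρ i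

theorem isIrreducible_of_comp {N : Type*} [Group N] (i : N →* G) {ρ : Representation ℂ G V}
    (h : (pullback i ρ).IsIrreducible) : ρ.IsIrreducible := by
  rw [isIrreducible_iff] at h ⊢
  exact ⟨h.1, fun U hU => h.2 U fun g => hU (i g)⟩

theorem isIrreducible_comp_mulEquiv {N : Type*} [Group N] (e : N ≃* G)
    {ρ : Representation ℂ G V} (h : ρ.IsIrreducible) :
    (pullback e.toMonoidHom ρ).IsIrreducible := by
  rw [isIrreducible_iff] at h ⊢
  refine ⟨h.1, fun U hU => h.2 U fun g v hv => ?_⟩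
  have := hU (e.symm g) v hv
  simpa using this

/-- The twist `g ↦ lam g • ρ g` of a representation by a linear character. -/
def twist (lam : G →* ℂˣ) (ρ : Representation ℂ G V) : Representation ℂ G V where
  toFun g := (lam g : ℂ) • ρ g
  map_one' := by simp
  map_mul' g h := by
    ext v
    simp only [map_mul, Units.val_mul, Module.End.mul_apply, LinearMap.smul_apply, map_smul,
      mul_smul]
    rw [smul_comm]

theorem twist_apply (lam : G →* ℂˣ) (ρ : Representation ℂ G V) (g : G) :
    twist lam ρ g = (lam g : ℂ) • ρ g := rfl

theorem twist_character (lam : G →* ℂˣ) (ρ : Representation ℂ G V) :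
    (twist lam ρ).character = fun g => (lam g : ℂ) * ρ.character g := by
  ext g
  simp [character, twist_apply]

theorem isIrreducible_twist (lam : G →* ℂˣ) {ρ : Representation ℂ G V}
    (h : ρ.IsIrreducible) : (twist lam ρ).IsIrreducible := by
  rw [isIrreducible_iff] at h ⊢
  refine ⟨h.1, fun U hU => h.2 U fun g v hv => ?_⟩
  have := U.smul_mem ((lam g)⁻¹ : ℂˣ) (hU g v hv)
  simpa [twist_apply, Units.smul_def, smul_smul] using this

end Representations

section Irr

variable {G : Type*} [Group G]

theorem irr_mul_linear {χ : G → ℂ} (h : χ ∈ Irr G) (lam : G →* ℂˣ) :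
    (fun g => (lam g : ℂ) * χ g) ∈ Irr G := by
  obtain ⟨n, ρ, hρ, rfl⟩ := h
  exact ⟨n, twist lam ρ, isIrreducible_twist lam hρ, (twist_character lam ρ).symm⟩

theorem irr_comp_mulEquiv {N : Type*} [Group N] (e : N ≃* G) {χ : G → ℂ} (h : χ ∈ Irr G) :
    (fun g => χ (e g)) ∈ Irr N := by
  obtain ⟨n, ρ, hρ, rfl⟩ := h
  exact ⟨n, pullback e.toMonoidHom ρ, isIrreducible_comp_mulEquiv e hρ, rfl⟩

theorem irr_conj {χ : G → ℂ} (h : χ ∈ Irr G) (x g : G) : χ (x * g * x⁻¹) = χ g := by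
  obtain ⟨n, ρ, hρ, rfl⟩ := h
  exact char_conj ρ g x

theorem linear_mem_irr (lam : G →* ℂˣ) : (fun g => (lam g : ℂ)) ∈ Irr G := by
  let τ : Representation ℂ G ℂ := 1
  have hτ : τ.IsIrreducible := by
    rw [isIrreducible_iff]
    refine ⟨inferInstance, fun U _ => eq_bot_or_eq_top U⟩
  have h := irr_mul_linear (character_mem_irr hτ) lam
  have h1 : (fun g => (lam g : ℂ) * τ.character g) = fun g => (lam g : ℂ) := by
    ext g
    simp [character, τ]
  rwa [h1] at h

theorem one_mem_irr : (1 : G → ℂ) ∈ Irr G := by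
  have h := linear_mem_irr (1 : G →* ℂˣ)
  simp only [MonoidHom.one_apply, Units.val_one] at h
  exact h

/-- The restriction of an irreducible character is a character. -/
theorem restrict_mem_closure {N : Type*} [Group N] [Finite N] (i : N →* G) {χ : G → ℂ}
    (h : χ ∈ Irr G) : (fun n => χ (i n)) ∈ AddSubmonoid.closure (Irr N) := by
  obtain ⟨n, ρ, hρ, rfl⟩ := h
  exact character_mem_closure (pullback i ρ)

theorem irr_apply_one {χ : G → ℂ} (h : χ ∈ Irr G) : ∃ d : ℕ, 0 < d ∧ χ 1 = d := by
  obtain ⟨n, ρ, hρ, rfl⟩ := h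
  have := ((isIrreducible_iff ρ).1 hρ).1
  exact ⟨_, Module.finrank_pos (R := ℂ) (M := Fin n → ℂ), by simp⟩

/-- An irreducible character of degree one is a homomorphism to `ℂˣ`. -/
theorem exists_hom_of_apply_one {χ : G → ℂ} (h : χ ∈ Irr G) (h1 : χ 1 = 1) :
    ∃ lam : G →* ℂˣ, ∀ g, χ g = lam g := by
  obtain ⟨n, ρ, hρ, rfl⟩ := h
  have hn : n = 1 := by
    rw [char_one] at h1
    simpa using h1
  subst hn
  refine ⟨(Units.map (LinearMap.det : (_ →ₗ[ℂ] _) →* ℂ)).comp ρ.asGroupHom, fun g => ?_⟩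
  have key : ∀ f : (Fin 1 → ℂ) →ₗ[ℂ] (Fin 1 → ℂ), LinearMap.trace ℂ _ f = LinearMap.det f := by
    intro f
    rw [LinearMap.trace_eq_matrix_trace ℂ (Pi.basisFun ℂ (Fin 1)),
      ← LinearMap.det_toMatrix (Pi.basisFun ℂ (Fin 1))]
    simp [Matrix.trace]
  simp [character, key, asGroupHom_apply]

end Irr

/-! ### The pairing of characters -/

section InnerProduct

variable {G : Type*} [Group G]

/-- The bilinear pairing `|G|⁻¹ ∑ x, f x * g x⁻¹` of functions on a finite group. On characters it
agrees with the usual inner product, since `χ x⁻¹` is the complex conjugate of `χ x`. -/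
noncomputable def ip (f g : G → ℂ) : ℂ := (Nat.card G : ℂ)⁻¹ * ∑ᶠ x, f x * g x⁻¹

theorem ip_eq_sum [Fintype G] (f g : G → ℂ) :
    ip f g = (Nat.card G : ℂ)⁻¹ * ∑ x, f x * g x⁻¹ := by
  rw [ip, finsum_eq_sum_of_fintype]

theorem ip_comm (f g : G → ℂ) : ip f g = ip g f := by
  rw [ip, ip]
  congr 1
  rw [← finsum_comp_equiv (Equiv.inv G)]
  exact finsum_congr fun x => by simp [mul_comm]

theorem ip_comp_mulEquiv {N : Type*} [Group N] (e : N ≃* G) (f g : G → ℂ) :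
    ip (fun x => f (e x)) (fun x => g (e x)) = ip f g := by
  rw [ip, ip, Nat.card_congr e.toEquiv, ← finsum_comp_equiv e.toEquiv]
  congr 1
  exact finsum_congr fun x => by simp

theorem ip_mul_linear (lam : G →* ℂˣ) (f g : G → ℂ) :
    ip (fun x => (lam x : ℂ) * f x) g = ip f fun x => ((lam⁻¹ : G →* ℂˣ) x : ℂ) * g x := by
  rw [ip, ip]
  congr 1
  refine finsum_congr fun x => ?_
  simp
  ring

theorem ip_zero_left (g : G → ℂ) : ip 0 g = 0 := by
  simp [ip]

variable [Finite G]

theorem ip_add_left (f₁ f₂ g : G → ℂ) : ip (f₁ + f₂) g = ip f₁ g + ip f₂ g := by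
  have := Fintype.ofFinite G
  simp [ip_eq_sum, add_mul, Finset.sum_add_distrib, mul_add]

theorem ip_smul_left (c : ℂ) (f g : G → ℂ) : ip (c • f) g = c * ip f g := by
  have := Fintype.ofFinite G
  simp only [ip_eq_sum, Pi.smul_apply, smul_eq_mul, mul_assoc, ← Finset.mul_sum]
  ring

theorem ip_sum_left {ι : Type*} (s : Finset ι) (F : ι → G → ℂ) (g : G → ℂ) :
    ip (∑ i ∈ s, F i) g = ∑ i ∈ s, ip (F i) g := by
  classical
  induction s using Finset.induction_on with
  | empty => simp [ip_zero_left]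
  | insert a s ha ih => rw [Finset.sum_insert ha, ip_add_left, ih, Finset.sum_insert ha]

theorem ip_character {V W : Type*} [AddCommGroup V] [Module ℂ V] [FiniteDimensional ℂ V]
    [AddCommGroup W] [Module ℂ W] [FiniteDimensional ℂ W] (ρ : Representation ℂ G V)
    (σ : Representation ℂ G W) :
    ip σ.character ρ.character = Module.finrank ℂ (IntertwiningMap ρ σ) := by
  have := Fintype.ofFinite G
  have : Invertible (Nat.card G : ℂ) := invertibleOfNonzero (Nat.cast_ne_zero.2 Nat.card_pos.ne')
  rw [ip_eq_sum]
  exact card_inv_mul_sum_char_mul_char_eq_finrank ρ σ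

theorem exists_intertwining_of_ip_ne_zero {V W : Type*} [AddCommGroup V] [Module ℂ V]
    [FiniteDimensional ℂ V] [AddCommGroup W] [Module ℂ W] [FiniteDimensional ℂ W]
    {ρ : Representation ℂ G V} {σ : Representation ℂ G W}
    (h : ip σ.character ρ.character ≠ 0) :
    ∃ f : V →ₗ[ℂ] W, f ≠ 0 ∧ ∀ g v, f (ρ g v) = σ g (f v) := by
  rw [ip_character] at h
  have : Nontrivial (IntertwiningMap ρ σ) :=
    Module.nontrivial_of_finrank_pos (R := ℂ) (Nat.pos_of_ne_zero fun h0 => h (by rw [h0]; simp))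
  obtain ⟨F, hF⟩ := exists_ne (0 : IntertwiningMap ρ σ)
  exact ⟨F.toLinearMap, fun h0 => hF (IntertwiningMap.ext h0),
    fun g v => IntertwiningMap.isIntertwining _ _ F g v⟩

theorem ip_self {χ : G → ℂ} (h : χ ∈ Irr G) : ip χ χ = 1 := by
  obtain ⟨n, ρ, hρ, rfl⟩ := h
  rw [ip_character, IsIrreducible.finrank_intertwiningMap_self]
  simp

theorem exists_equiv_of_ip_ne_zero {V W : Type*} [AddCommGroup V] [Module ℂ V]
    [FiniteDimensional ℂ V] [AddCommGroup W] [Module ℂ W] [FiniteDimensional ℂ W]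
    {ρ : Representation ℂ G V} {σ : Representation ℂ G W} (hρ : ρ.IsIrreducible)
    (hσ : σ.IsIrreducible) (h : ip σ.character ρ.character ≠ 0) : Nonempty (ρ.Equiv σ) := by
  obtain ⟨f, hf, hfg⟩ := exists_intertwining_of_ip_ne_zero h
  exact exists_equiv_of_ne_zero hρ hσ f hfg hf

theorem eq_of_ip_ne_zero {χ θ : G → ℂ} (hχ : χ ∈ Irr G) (hθ : θ ∈ Irr G) (h : ip χ θ ≠ 0) :
    χ = θ := by
  obtain ⟨n, ρ, hρ, rfl⟩ := hχ
  obtain ⟨m, σ, hσ, rfl⟩ := hθ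
  obtain ⟨e⟩ := exists_equiv_of_ip_ne_zero hσ hρ h
  exact (char_iso e).symm

open Classical in
theorem ip_irr {χ θ : G → ℂ} (hχ : χ ∈ Irr G) (hθ : θ ∈ Irr G) :
    ip χ θ = if χ = θ then 1 else 0 := by
  split_ifs with h
  · rw [← h, ip_self hχ]
  · by_contra h0
    exact h (eq_of_ip_ne_zero hχ hθ h0)

theorem linearIndependent_irr : LinearIndependent ℂ (fun χ : Irr G => (χ : G → ℂ)) := by
  classical
  rw [linearIndependent_iff']
  intro s c hc χ hχ
  have h := congrArg (fun f => ip f χ.1) hc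
  simp only [ip_sum_left, ip_smul_left, ip_zero_left] at h
  rw [Finset.sum_eq_single χ] at h
  · rwa [ip_self χ.2, mul_one] at h
  · intro θ _ hne
    rw [ip_irr θ.2 χ.2, if_neg fun e => hne (Subtype.ext e), mul_zero]
  · exact fun h => absurd hχ h

theorem finite_irr (G : Type*) [Group G] [Finite G] : (Irr G).Finite :=
  linearIndependent_irr.setFinite

theorem exists_nat_ip {f θ : G → ℂ} (hf : f ∈ AddSubmonoid.closure (Irr G)) (hθ : θ ∈ Irr G) :
    ∃ n : ℕ, ip f θ = n := by
  classical
  induction hf using AddSubmonoid.closure_induction with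
  | mem x hx =>
    rw [ip_irr hx hθ]
    split_ifs
    exacts [⟨1, by simp⟩, ⟨0, by simp⟩]
  | zero => exact ⟨0, by simp [ip_zero_left]⟩
  | add x y _ _ h1 h2 =>
    obtain ⟨a, ha⟩ := h1
    obtain ⟨b, hb⟩ := h2
    exact ⟨a + b, by rw [ip_add_left, ha, hb]; simp⟩

/-- The decomposition of a character into irreducible constituents. -/
theorem eq_sum_ip_smul {f : G → ℂ} (hf : f ∈ AddSubmonoid.closure (Irr G)) :
    f = ∑ θ ∈ (finite_irr G).toFinset, ip f θ • θ := by
  classical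
  induction hf using AddSubmonoid.closure_induction with
  | mem x hx =>
    rw [Finset.sum_eq_single x]
    · rw [ip_self hx, one_smul]
    · intro θ hθ hne
      rw [ip_irr hx (by simpa using hθ), if_neg hne.symm, zero_smul]
    · exact fun h => absurd (by simpa using hx) h
  | zero => simp [ip_zero_left]
  | add x y _ _ h1 h2 =>
    simp only [ip_add_left, add_smul, Finset.sum_add_distrib]
    rw [← h1, ← h2]

theorem exists_ip_ne_zero {f : G → ℂ} (hf : f ∈ AddSubmonoid.closure (Irr G)) (h0 : f ≠ 0) :
    ∃ θ ∈ Irr G, ip f θ ≠ 0 := by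
  by_contra! h
  refine h0 ?_
  rw [eq_sum_ip_smul hf]
  exact Finset.sum_eq_zero fun θ hθ => by rw [h θ (by simpa using hθ), zero_smul]

/-- A character fixed by an automorphism comes with an operator implementing it. -/
theorem exists_linearEquiv_of_comp_eq {V : Type*} [AddCommGroup V] [Module ℂ V]
    [FiniteDimensional ℂ V] {ρ : Representation ℂ G V} (hρ : ρ.IsIrreducible) (c : MulAut G)
    (h : ∀ g, ρ.character (c g) = ρ.character g) :
    ∃ T : V ≃ₗ[ℂ] V, ∀ g v, T (ρ g v) = ρ (c g) (T v) := by
  have hσ := isIrreducible_comp_mulEquiv c hρ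
  have heq : (pullback (c : G ≃* G).toMonoidHom ρ).character = ρ.character := funext h
  obtain ⟨e⟩ := exists_equiv_of_ip_ne_zero hρ hσ (by
    rw [heq, ip_self (character_mem_irr hρ)]; exact one_ne_zero)
  exact ⟨e.toLinearEquiv, fun g v => IntertwiningMap.isIntertwining _ _ e.toIntertwiningMap g v⟩

end InnerProduct

section Regular

variable {G : Type*} [Group G] [Finite G]

open Classical in
/-- The regular character, `|G|` at `1` and `0` elsewhere, is a character. -/
theorem regular_mem_closure :
    (fun x : G => if x = 1 then (Nat.card G : ℂ) else 0) ∈ AddSubmonoid.closure (Irr G) := by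
  have := Fintype.ofFinite G
  let R : Representation ℂ G (G → ℂ) :=
    { toFun := fun g => LinearMap.funLeft ℂ ℂ (fun x => g⁻¹ * x)
      map_one' := by ext; simp [LinearMap.funLeft]
      map_mul' := fun g h => by
        ext f x
        simp [LinearMap.funLeft, mul_assoc] }
  have hR : R.character = fun x : G => if x = 1 then (Nat.card G : ℂ) else 0 := by
    ext g
    rw [character, LinearMap.trace_eq_matrix_trace ℂ (Pi.basisFun ℂ G), Matrix.trace]
    have : ∀ x : G, (LinearMap.toMatrix (Pi.basisFun ℂ G) (Pi.basisFun ℂ G) (R g)).diag x =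
        if g = 1 then 1 else 0 := by
      intro x
      simp [R, LinearMap.funLeft, Pi.single_apply]
    rw [Finset.sum_congr rfl fun x _ => this x]
    simp
  rw [← hR]
  exact character_mem_closure R

end Regular

/-! ### Clifford theory -/

section Clifford

/-! Throughout, `i : N →* L` plays the role of the inclusion of a normal subgroup and
`c : L →* MulAut N` that of the conjugation action. -/

variable {N L : Type*} [Group N] [Group L]

/-- The action of `L` on functions on `N` induced by an action `c` by automorphisms. -/
@[reducible] def conjAction (c : L →* MulAut N) : MulAction L (N → ℂ) where
  smul l θ := fun n => θ (c l⁻¹ n)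
  one_smul θ := by
    ext n
    change θ (c 1⁻¹ n) = θ n
    simp
  mul_smul l l' θ := by
    ext n
    change θ (c (l * l')⁻¹ n) = θ (c l'⁻¹ (c l⁻¹ n))
    simp

/-- The inertia group of a function on `N`: its stabilizer under the action `c`. -/
def inertia (c : L →* MulAut N) (θ : N → ℂ) : Subgroup L where
  carrier := {l | ∀ n, θ (c l n) = θ n}
  one_mem' := by simp
  mul_mem' {a b} ha hb n := by
    rw [map_mul, MulAut.mul_apply, ha, hb]
  inv_mem' {a} ha n := by
    rw [← ha (c a⁻¹ n), ← MulAut.mul_apply, ← map_mul]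
    simp

theorem mem_inertia {c : L →* MulAut N} {θ : N → ℂ} {l : L} :
    l ∈ inertia c θ ↔ ∀ n, θ (c l n) = θ n := Iff.rfl

theorem ncard_orbit_eq_index_inertia (c : L →* MulAut N) (θ : N → ℂ) :
    (Set.range fun l : L => fun n => θ (c l n)).ncard = (inertia c θ).index := by
  let _ := conjAction c
  have h1 : MulAction.stabilizer L θ = inertia c θ := by
    ext l
    rw [← inv_mem_iff, MulAction.mem_stabilizer_iff, mem_inertia, funext_iff]
    change (∀ n, θ (c l⁻¹⁻¹ n) = θ n) ↔ _
    rw [inv_inv]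
  have h2 : MulAction.orbit L θ = Set.range fun l : L => fun n => θ (c l n) := by
    rw [MulAction.orbit, ← (Equiv.inv L).surjective.range_comp]
    congr 1
    ext l n
    change θ (c l⁻¹⁻¹ n) = _
    simp
  rw [← h1, ← h2, MulAction.index_stabilizer]

variable (i : N →* L) (c : L →* MulAut N) (hic : ∀ l n, i (c l n) = l * i n * l⁻¹)

include hic in
/-- Any two irreducible constituents of the restriction of an irreducible character to a normal
subgroup are conjugate. -/
theorem conj_of_constituents [Finite N] {χ : L → ℂ} (hχ : χ ∈ Irr L) {θ θ' : N → ℂ}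
    (hθ : θ ∈ Irr N) (hθ' : θ' ∈ Irr N) (h : ip (fun n => χ (i n)) θ ≠ 0)
    (h' : ip (fun n => χ (i n)) θ' ≠ 0) : ∃ l, ∀ n, θ n = θ' (c l n) := by
  obtain ⟨d, ρ, hρ, rfl⟩ := hχ
  obtain ⟨a, τ, hτ, rfl⟩ := hθ
  obtain ⟨a', τ', hτ', rfl⟩ := hθ'
  obtain ⟨f, hf0, hf⟩ := exists_intertwining_of_ip_ne_zero (σ := pullback i ρ) h
  rw [ip_comm] at h'
  obtain ⟨f', hf0', hf'⟩ := exists_intertwining_of_ip_ne_zero (ρ := pullback i ρ) h'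
  obtain ⟨u, hu⟩ : ∃ u, f u ≠ 0 := by
    by_contra! hc
    exact hf0 (LinearMap.ext hc)
  have hex : ∃ l, f' (ρ l (f u)) ≠ 0 := by
    by_contra! hc
    let U : Submodule ℂ (Fin d → ℂ) := ⨅ l, LinearMap.ker (f' ∘ₗ ρ l)
    have hmem : ∀ v, v ∈ U ↔ ∀ l, f' (ρ l v) = 0 := fun v => by
      simp [U, Submodule.mem_iInf]
    rcases ((isIrreducible_iff ρ).1 hρ).2 U (fun g v hv => by
      rw [hmem] at hv ⊢
      intro l
      have := hv (l * g)
      rwa [map_mul, Module.End.mul_apply] at this) with hU | hU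
    · have : f u ∈ U := (hmem _).2 hc
      rw [hU] at this
      exact hu this
    · refine hf0' (LinearMap.ext fun v => ?_)
      have : v ∈ U := hU ▸ trivial
      simpa using (hmem v).1 this 1
  obtain ⟨l, hl⟩ := hex
  have hne : f' ∘ₗ ρ l ∘ₗ f ≠ 0 := fun h0 => hl (by
    have := LinearMap.congr_fun h0 u
    simpa using this)
  obtain ⟨e⟩ := exists_equiv_of_ne_zero hτ
    (isIrreducible_comp_mulEquiv (c l) hτ' : (pullback (c l : N ≃* N).toMonoidHom τ').IsIrreducible)
    (f' ∘ₗ ρ l ∘ₗ f) (fun n v => by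
      have h1 : l * i n = i (c l n) * l := by rw [hic]; group
      have h2 : ρ l (ρ (i n) (f v)) = ρ (i (c l n)) (ρ l (f v)) := by
        rw [← Module.End.mul_apply, ← map_mul, h1, map_mul, Module.End.mul_apply]
      have h3 : f (τ n v) = ρ (i n) (f v) := hf n v
      have h4 : ∀ m w, f' (ρ (i m) w) = τ' m (f' w) := fun m w => hf' m w
      change f' (ρ l (f (τ n v))) = τ' (c l n) (f' (ρ l (f v)))
      rw [h3, h2, h4]) hne
  exact ⟨l, fun n => congrFun (char_iso e) n⟩

include hic in
theorem ip_restrict_conj [Finite N] {χ : L → ℂ} (hχ : χ ∈ Irr L) (θ : N → ℂ) (l : L) :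
    ip (fun n => χ (i n)) (fun n => θ (c l n)) = ip (fun n => χ (i n)) θ := by
  rw [← ip_comp_mulEquiv (c l) (fun n => χ (i n)) θ]
  congr 1
  ext n
  rw [hic, irr_conj hχ]

include hic in
/-- Clifford's theorem: the restriction of an irreducible character to a normal subgroup is a
multiple of an orbit sum. -/
theorem restrict_eq_orbit_sum [Finite N] [Finite L] {χ : L → ℂ} (hχ : χ ∈ Irr L) {θ : N → ℂ}
    (hθ : θ ∈ Irr N) (h : ip (fun n => χ (i n)) θ ≠ 0) :
    (fun n => χ (i n)) = ∑ θ' ∈ (Set.toFinite (Set.range fun l : L => fun n => θ (c l n))).toFinset,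
      ip (fun n => χ (i n)) θ • θ' := by
  classical
  conv_lhs => rw [eq_sum_ip_smul (restrict_mem_closure i hχ)]
  symm
  refine (Finset.sum_congr rfl fun θ' hθ' => ?_).trans
    (Finset.sum_subset (fun θ' hθ' => ?_) fun θ' hθ' hn => ?_)
  · obtain ⟨l, rfl⟩ := (Set.Finite.mem_toFinset _).1 hθ'
    congr 1
    exact (ip_restrict_conj i c hic hχ θ l).symm
  · obtain ⟨l, rfl⟩ := (Set.Finite.mem_toFinset _).1 hθ'
    exact (Set.Finite.mem_toFinset _).2 (irr_comp_mulEquiv (c l) hθ)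
  · by_contra h0
    have h1 : ip (fun n => χ (i n)) θ' ≠ 0 := fun h1 => h0 (by rw [h1, zero_smul])
    obtain ⟨l, hl⟩ := conj_of_constituents i c hic hχ
      ((Set.Finite.mem_toFinset _).1 hθ') hθ h1 h
    exact hn ((Set.Finite.mem_toFinset _).2 ⟨l, (funext hl).symm⟩)

include hic in
/-- The degree form of Clifford's theorem; the index of the inertia group is the length of the orbit of
the constituent. -/
theorem apply_one_eq_mul_index [Finite N] [Finite L] {χ : L → ℂ} (hχ : χ ∈ Irr L) {θ : N → ℂ}
    (hθ : θ ∈ Irr N) (h : ip (fun n => χ (i n)) θ ≠ 0) :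
    χ 1 = ip (fun n => χ (i n)) θ * (inertia c θ).index * θ 1 := by
  have h1 := congrFun (restrict_eq_orbit_sum i c hic hχ hθ h) 1
  rw [map_one, Finset.sum_apply] at h1
  rw [h1, Finset.sum_congr rfl (g := fun _ => ip (fun n => χ (i n)) θ * θ 1) fun θ' hθ' => ?_]
  · rw [Finset.sum_const, ← Set.ncard_eq_toFinset_card _ (Set.toFinite _),
      ncard_orbit_eq_index_inertia, nsmul_eq_mul]
    ring
  · obtain ⟨l, rfl⟩ := (Set.Finite.mem_toFinset _).1 hθ'
    simp

include hic in
theorem ip_restrict_self [Finite N] [Finite L] {χ : L → ℂ} (hχ : χ ∈ Irr L) {θ : N → ℂ}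
    (hθ : θ ∈ Irr N) (h : ip (fun n => χ (i n)) θ ≠ 0) :
    ip (fun n => χ (i n)) (fun n => χ (i n)) =
      ip (fun n => χ (i n)) θ ^ 2 * (inertia c θ).index := by
  conv_lhs => arg 1; rw [restrict_eq_orbit_sum i c hic hχ hθ h]
  rw [ip_sum_left, Finset.sum_congr rfl (g := fun _ => ip (fun n => χ (i n)) θ ^ 2) fun θ' hθ' => ?_]
  · rw [Finset.sum_const, ← Set.ncard_eq_toFinset_card _ (Set.toFinite _),
      ncard_orbit_eq_index_inertia, nsmul_eq_mul]
    ring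
  · obtain ⟨l, rfl⟩ := (Set.Finite.mem_toFinset _).1 hθ'
    rw [ip_smul_left, sq, ip_comm _ fun n => χ (i n)]
    congr 1
    exact ip_restrict_conj i c hic hχ θ l

/-- Every irreducible character of a subgroup lies under some irreducible character. -/
theorem exists_irr_over [Finite N] [Finite L] (hi : Function.Injective i) {θ : N → ℂ}
    (hθ : θ ∈ Irr N) : ∃ χ ∈ Irr L, ip (fun n => χ (i n)) θ ≠ 0 := by
  classical
  by_contra! hcon
  have key : ∀ f ∈ AddSubmonoid.closure (Irr L), ip (fun n => f (i n)) θ = 0 := by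
    intro f hf
    induction hf using AddSubmonoid.closure_induction with
    | mem x hx => exact hcon x hx
    | zero => exact ip_zero_left θ
    | add x y _ _ h1 h2 =>
      have := ip_add_left (fun n => x (i n)) (fun n => y (i n)) θ
      rw [h1, h2, add_zero] at this
      exact this
  have h := key _ regular_mem_closure
  rw [ip, finsum_eq_single _ 1 fun n hn => by
    rw [if_neg fun h => hn (hi (by rw [h, map_one])), zero_mul]] at h
  obtain ⟨d, hd, hd1⟩ := irr_apply_one hθ
  have h1 : (Nat.card N : ℂ) ≠ 0 := Nat.cast_ne_zero.2 Nat.card_pos.ne'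
  have h2 : (Nat.card L : ℂ) ≠ 0 := Nat.cast_ne_zero.2 Nat.card_pos.ne'
  have h3 : (d : ℂ) ≠ 0 := Nat.cast_ne_zero.2 hd.ne'
  simp [hd1, h1, h2, h3] at h

end Clifford

/-! ### Characters over an abelian quotient -/

section AbelianQuotient

variable {N L : Type*} [Group N] [Group L]

/-- The linear characters of `L` which are trivial on the image of `i : N →* L`. -/
def linTriv (i : N →* L) : Subgroup (L →* ℂˣ) where
  carrier := {lam | ∀ n, lam (i n) = 1}
  one_mem' n := rfl
  mul_mem' {a b} ha hb n := by
    rw [MonoidHom.mul_apply, ha n, hb n, one_mul]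
  inv_mem' {a} ha n := by
    rw [MonoidHom.inv_apply, ha n, inv_one]

/-- Linear characters separate the points of an abelian quotient. -/
theorem exists_hom_apply_ne_one [Finite L] {D : Subgroup L} (hD : commutator L ≤ D) {x : L}
    (hx : x ∉ D) : ∃ lam : L →* ℂˣ, (∀ d ∈ D, lam d = 1) ∧ lam x ≠ 1 := by
  have hn : D.Normal := Subgroup.Normal.of_commutator_le L hD
  have hc : IsMulCommutative (L ⧸ D) :=
    Subgroup.Normal.quotient_commutative_iff_commutator_le.2 hD
  let _ : CommGroup (L ⧸ D) := { (inferInstance : Group (L ⧸ D)) with mul_comm := hc.1.1 }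
  obtain ⟨lam, hlam⟩ := CommGroup.exists_apply_ne_one_of_hasEnoughRootsOfUnity (L ⧸ D) ℂ
    (a := (x : L ⧸ D)) (fun h => hx ((QuotientGroup.eq_one_iff x).1 h))
  refine ⟨lam.comp (QuotientGroup.mk' D), fun d hd => ?_, hlam⟩
  rw [MonoidHom.comp_apply, QuotientGroup.mk'_apply, (QuotientGroup.eq_one_iff d).2 hd, map_one]

variable (i : N →* L)

open Classical in
theorem sum_linTriv_apply [Finite L] (hc : commutator L ≤ i.range) [Fintype (linTriv i)] (x : L) :
    ∑ lam : linTriv i, ((lam.1 x : ℂˣ) : ℂ) =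
      if x ∈ i.range then (Nat.card (linTriv i) : ℂ) else 0 := by
  split_ifs with hx
  · obtain ⟨n, rfl⟩ := hx
    rw [Finset.sum_congr rfl fun lam _ => by rw [lam.2 n, Units.val_one]]
    simp
  · obtain ⟨μ, hμ, hμx⟩ := exists_hom_apply_ne_one hc hx
    have hμB : μ ∈ linTriv i := fun n => hμ _ ⟨n, rfl⟩
    have h := Equiv.sum_comp (Equiv.mulLeft (⟨μ, hμB⟩ : linTriv i))
      (fun lam : linTriv i => ((lam.1 x : ℂˣ) : ℂ))
    simp only [Equiv.coe_mulLeft, Subgroup.coe_mul, MonoidHom.mul_apply, Units.val_mul,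
      ← Finset.mul_sum] at h
    by_contra h0
    exact hμx (Units.ext (by simpa using mul_right_cancel₀ h0 (h.trans (one_mul _).symm)))

theorem card_linTriv_mul_card [Finite L] (hi : Function.Injective i)
    (hc : commutator L ≤ i.range) : Nat.card (linTriv i) * Nat.card N = Nat.card L := by
  classical
  have := Fintype.ofFinite (linTriv i)
  have := Fintype.ofFinite L
  have h : ∑ x : L, ∑ lam : linTriv i, ((lam.1 x : ℂˣ) : ℂ) = (Nat.card L : ℂ) := by
    rw [Finset.sum_comm]
    have hL : (Nat.card L : ℂ) ≠ 0 := Nat.cast_ne_zero.2 Nat.card_pos.ne'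
    have h1 : ∀ lam : linTriv i, ∑ x : L, ((lam.1 x : ℂˣ) : ℂ) =
        if lam = 1 then (Nat.card L : ℂ) else 0 := by
      intro lam
      have := ip_irr (linear_mem_irr lam.1) (one_mem_irr (G := L))
      rw [ip_eq_sum, inv_mul_eq_iff_eq_mul₀ hL] at this
      simp only [Pi.one_apply, mul_one] at this
      rw [this]
      have h2 : ((fun g => ((lam.1 g : ℂˣ) : ℂ)) = 1) ↔ lam = 1 := by
        refine ⟨fun h => Subtype.ext (MonoidHom.ext fun g => Units.ext (congrFun h g)), ?_⟩
        rintro rfl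
        rfl
      simp only [h2]
      split_ifs <;> simp
    simp [h1]
  simp only [sum_linTriv_apply i hc] at h
  rw [← Finset.sum_filter, Finset.sum_const, nsmul_eq_mul, ← Nat.cast_mul, Nat.cast_inj] at h
  rw [← h, mul_comm]
  congr 1
  rw [Nat.card_congr (MonoidHom.ofInjective hi).toEquiv, Nat.card_eq_fintype_card,
    Fintype.card_subtype]

/-- Summing over the linear characters of an abelian quotient turns the pairing of two functions
into the pairing of their restrictions. -/
theorem sum_ip_linTriv [Finite L] [Finite N] (hi : Function.Injective i)
    (hc : commutator L ≤ i.range) [Fintype (linTriv i)] (f g : L → ℂ) :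
    ∑ lam : linTriv i, ip (fun x => (lam.1 x : ℂ) * f x) g =
      ip (fun n => f (i n)) fun n => g (i n) := by
  classical
  have := Fintype.ofFinite N
  have := Fintype.ofFinite L
  simp only [ip_eq_sum]
  rw [← Finset.mul_sum, Finset.sum_comm]
  have h1 : ∀ x, ∑ lam : linTriv i, (lam.1 x : ℂ) * f x * g x⁻¹ =
      if x ∈ i.range then (Nat.card (linTriv i) : ℂ) * (f x * g x⁻¹) else 0 := by
    intro x
    simp only [mul_assoc]
    rw [← Finset.sum_mul, sum_linTriv_apply i hc]
    split_ifs <;> simp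
  simp only [h1]
  rw [← Finset.sum_filter, ← Finset.mul_sum]
  have h2 : ∑ x with x ∈ i.range, f x * g x⁻¹ = ∑ n, f (i n) * g (i n⁻¹) := by
    symm
    refine Finset.sum_bij (fun n _ => i n) (fun n _ => by simp) (fun a _ b _ h => hi h)
      (fun x hx => ?_) (fun n _ => by simp)
    obtain ⟨n, hn⟩ := (Finset.mem_filter.1 hx).2
    exact ⟨n, Finset.mem_univ _, hn⟩
  rw [h2, ← mul_assoc]
  congr 1
  rw [← card_linTriv_mul_card i hi hc]
  have hN : (Nat.card N : ℂ) ≠ 0 := Nat.cast_ne_zero.2 Nat.card_pos.ne'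
  have hB : (Nat.card (linTriv i) : ℂ) ≠ 0 := Nat.cast_ne_zero.2 Nat.card_pos.ne'
  push_cast
  field_simp

/-- If the restriction of `χ` to `i` contains the trivial character, then `χ` contains a linear
character which is trivial on the image of `i`. -/
theorem exists_linTriv_ip_ne_zero [Finite L] [Finite N] (hi : Function.Injective i)
    (hc : commutator L ≤ i.range) {χ : L → ℂ} (h : ip (fun n => χ (i n)) 1 ≠ 0) :
    ∃ lam ∈ linTriv i, ip χ (fun x => (lam x : ℂ)) ≠ 0 := by
  have := Fintype.ofFinite (linTriv i)
  have h1 := sum_ip_linTriv i hi hc χ 1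
  rw [show (fun n => (1 : L → ℂ) (i n)) = 1 from rfl] at h1
  rw [← h1] at h
  obtain ⟨lam, -, hlam⟩ := Finset.exists_ne_zero_of_sum_ne_zero h
  rw [ip_mul_linear] at hlam
  exact ⟨lam.1⁻¹, inv_mem lam.2, by simpa using hlam⟩

variable (c : L →* MulAut N) (hic : ∀ l n, i (c l n) = l * i n * l⁻¹)

include hic in
/-- For an abelian quotient, two irreducible characters over the same irreducible character of the
normal subgroup differ by a linear character of the quotient. -/
theorem exists_linTriv_mul_eq [Finite L] [Finite N] (hi : Function.Injective i)
    (hc : commutator L ≤ i.range) {φ₁ φ₂ : L → ℂ} (h₁ : φ₁ ∈ Irr L) (h₂ : φ₂ ∈ Irr L)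
    {θ : N → ℂ} (hθ : θ ∈ Irr N) (hθ₁ : ip (fun n => φ₁ (i n)) θ ≠ 0)
    (hθ₂ : ip (fun n => φ₂ (i n)) θ ≠ 0) :
    ∃ lam ∈ linTriv i, φ₂ = fun x => (lam x : ℂ) * φ₁ x := by
  have := Fintype.ofFinite (linTriv i)
  have h0 : ip (fun n => φ₁ (i n)) (fun n => φ₂ (i n)) ≠ 0 := by
    rw [restrict_eq_orbit_sum i c hic h₁ hθ hθ₁, ip_sum_left,
      Finset.sum_congr rfl
        (g := fun _ => ip (fun n => φ₁ (i n)) θ * ip (fun n => φ₂ (i n)) θ) fun θ' hθ' => ?_]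
    · rw [Finset.sum_const, ← Set.ncard_eq_toFinset_card _ (Set.toFinite _),
        ncard_orbit_eq_index_inertia, nsmul_eq_mul]
      exact mul_ne_zero (Nat.cast_ne_zero.2 Subgroup.index_ne_zero_of_finite)
        (mul_ne_zero hθ₁ hθ₂)
    · obtain ⟨l, rfl⟩ := (Set.Finite.mem_toFinset _).1 hθ'
      rw [ip_smul_left, ip_comm _ fun n => φ₂ (i n)]
      congr 1
      exact ip_restrict_conj i c hic h₂ θ l
  rw [← sum_ip_linTriv i hi hc] at h0
  obtain ⟨lam, -, hlam⟩ := Finset.exists_ne_zero_of_sum_ne_zero h0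
  exact ⟨lam.1, lam.2, (eq_of_ip_ne_zero (irr_mul_linear h₁ lam.1) h₂ hlam).symm⟩

include hic in
theorem exists_nat_degree_eq [Finite L] [Finite N] {χ : L → ℂ} (hχ : χ ∈ Irr L)
    {θ : N → ℂ} (hθ : θ ∈ Irr N) (h : ip (fun n => χ (i n)) θ ≠ 0) {a b : ℕ} (ha : χ 1 = a)
    (hb : θ 1 = b) : ∃ m : ℕ, ip (fun n => χ (i n)) θ = m ∧ a = m * (inertia c θ).index * b := by
  obtain ⟨m, hm⟩ := exists_nat_ip (restrict_mem_closure i hχ) hθ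
  refine ⟨m, hm, ?_⟩
  have := apply_one_eq_mul_index i c hic hχ hθ h
  rw [ha, hb, hm] at this
  exact_mod_cast this

include hic in
/-- Over an elementary abelian `p`-quotient the degree of an irreducible character can only acquire
factors `p`. -/
theorem dvd_degree_of_dvd_degree [Finite L] [Finite N] (hi : Function.Injective i)
    (hc : commutator L ≤ i.range) {p : ℕ} (hp : p.Prime) (hpow : ∀ x : L, x ^ p ∈ i.range)
    {χ : L → ℂ} (hχ : χ ∈ Irr L) {θ : N → ℂ} (hθ : θ ∈ Irr N)
    (h : ip (fun n => χ (i n)) θ ≠ 0) {a b : ℕ} (ha : χ 1 = a) (hb : θ 1 = b) {q : ℕ}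
    (hq : q.Prime) (hqp : q ≠ p) (hqa : q ∣ a) : q ∣ b := by
  classical
  obtain ⟨m, hm, hab⟩ := exists_nat_degree_eq i c hic hχ hθ h ha hb
  have := Fintype.ofFinite (linTriv i)
  -- `T` has order `⟨χ|_N, χ|_N⟩ = m² |orbit|` and exponent `p`, so `q` divides neither factor.
  let T : Subgroup (linTriv i) :=
    { carrier := {lam | (fun x => (lam.1 x : ℂ) * χ x) = χ}
      one_mem' := by ext; simp
      mul_mem' := fun {x y} hx hy => by
        rw [Set.mem_ofPred_eq, funext_iff] at *
        intro l
        rw [Subgroup.coe_mul, MonoidHom.mul_apply, Units.val_mul, mul_assoc, hy, hx]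
      inv_mem' := fun {x} hx => by
        rw [Set.mem_ofPred_eq, funext_iff] at *
        intro l
        conv_lhs => rw [← hx l]
        simp }
  have hT : (Nat.card T : ℂ) = ip (fun n => χ (i n)) (fun n => χ (i n)) := by
    rw [← sum_ip_linTriv i hi hc]
    have : ∀ lam : linTriv i, ip (fun x => (lam.1 x : ℂ) * χ x) χ = if lam ∈ T then 1 else 0 :=
      fun lam => ip_irr (irr_mul_linear hχ lam.1) hχ
    simp only [this]
    rw [Finset.sum_boole, Nat.card_eq_fintype_card, Fintype.card_subtype]
  rw [ip_restrict_self i c hic hχ hθ h, hm] at hT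
  have hT' : Nat.card T = m ^ 2 * (inertia c θ).index := by exact_mod_cast hT
  rw [hab, hq.dvd_mul] at hqa
  rcases hqa with hqa | hqa
  · exfalso
    have hdvd : q ∣ Nat.card T := by
      rw [hT', hq.dvd_mul]
      rcases (hq.dvd_mul).1 hqa with h | h
      · exact Or.inl (dvd_pow h two_ne_zero)
      · exact Or.inr h
    have : Fact q.Prime := ⟨hq⟩
    obtain ⟨lam, hlam⟩ := exists_prime_orderOf_dvd_card' q hdvd
    have hone : lam ^ p = 1 := by
      refine Subtype.ext (Subtype.ext (MonoidHom.ext fun x => ?_))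
      obtain ⟨n, hn⟩ := hpow x
      change (lam.1.1 ^ p) x = 1
      rw [MonoidHom.pow_apply, ← map_pow, ← hn]
      exact lam.1.2 n
    have := orderOf_dvd_of_pow_eq_one hone
    rw [hlam] at this
    exact hqp ((Nat.prime_dvd_prime_iff_eq hq hp).1 this)
  · exact hqa

end AbelianQuotient

/-! ### Sections of solvable groups and conjugacy -/

section Group

theorem mem_of_pow_mem_of_coprime {G : Type*} [Group G] {N : Subgroup G} {x : G} {m n : ℕ}
    (hmn : m.Coprime n) (hm : x ^ m ∈ N) (hn : x ^ n ∈ N) : x ∈ N := by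
  have h : x = (x ^ m) ^ (m.gcdA n) * (x ^ n) ^ (m.gcdB n) := by
    rw [← zpow_natCast, ← zpow_natCast, ← zpow_mul, ← zpow_mul, ← zpow_add, ← Nat.gcd_eq_gcd_ab,
      hmn.gcd_eq_one]
    simp
  rw [h]
  exact mul_mem (zpow_mem hm _) (zpow_mem hn _)

/-- Glauberman's fixed point lemma for an abelian transitive group. The group `A` acts on the
orbit of `x₀` under `B`, compatibly with its action on `B`; a subgroup `A₀` of index prime to the
exponent of `B` fixes `x₀`. Averaging the cocycle `c` with `a • x₀ = c a • x₀` over `A ⧸ A₀` produces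
a fixed point of `A`. -/
theorem exists_smul_fixed {A B Y : Type*} [Group A] [Group B] [MulAction A Y] [MulAction B Y]
    (φ : A → B →* B) (hφ : ∀ a b (y : Y), a • b • y = φ a b • a • y) (x₀ : Y)
    (h : ∀ a : A, ∃ b : B, b • x₀ = a • x₀) (hcomm : commutator B ≤ MulAction.stabilizer B x₀)
    (A₀ : Subgroup A) [A₀.FiniteIndex] (hA₀ : ∀ a ∈ A₀, a • x₀ = x₀) {m : ℕ}
    (hm : m.Coprime A₀.index) (hpow : ∀ b : B, b ^ m • x₀ = x₀) :
    ∃ d : B, ∀ a : A, a • d • x₀ = d • x₀ := by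
  choose c hc using h
  set S := MulAction.stabilizer B x₀ with hS
  have hn : S.Normal := Subgroup.Normal.of_commutator_le B hcomm
  have hC : IsMulCommutative (B ⧸ S) :=
    Subgroup.Normal.quotient_commutative_iff_commutator_le.2 hcomm
  let _ : CommGroup (B ⧸ S) := { (inferInstance : Group (B ⧸ S)) with mul_comm := hC.1.1 }
  have hmk : ∀ b₁ b₂ : B, (b₁ : B ⧸ S) = b₂ ↔ b₁ • x₀ = b₂ • x₀ := by
    intro b₁ b₂
    rw [QuotientGroup.eq, hS, MulAction.mem_stabilizer_iff, mul_smul, inv_smul_eq_iff, eq_comm]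
  have hφS : ∀ a, S ≤ S.comap (φ a) := by
    intro a b hb
    have h1 : φ a b • a • x₀ = a • x₀ := by
      rw [← hφ, show b • x₀ = x₀ from hb]
    rw [← hc a, smul_smul, ← hmk, QuotientGroup.mk_mul, mul_eq_right,
      QuotientGroup.eq_one_iff] at h1
    exact h1
  let ψ : A → (B ⧸ S) →* (B ⧸ S) := fun a => QuotientGroup.map S S (φ a) (hφS a)
  have hψ : ∀ a (b : B), ψ a b = (φ a b : B ⧸ S) := fun a b => rfl
  have hcoc : ∀ a b, (c (a * b) : B ⧸ S) = ψ a (c b) * c a := by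
    intro a b
    rw [hψ, ← QuotientGroup.mk_mul, hmk, mul_smul, hc, hc, ← hφ, hc, mul_smul]
  have hcong : ∀ (a : A) (q : A ⧸ A₀),
      (c (a * q.out) : B ⧸ S) = c ((a • q).out) := by
    intro a q
    rw [hmk, hc, hc]
    have h1 : ((a • q).out)⁻¹ * (a * q.out) ∈ A₀ := by
      rw [← QuotientGroup.eq, QuotientGroup.out_eq']
      conv_lhs => rw [← QuotientGroup.out_eq' q]
      rfl
    have h2 := hA₀ _ h1
    rwa [mul_smul, inv_smul_eq_iff] at h2
  have := Fintype.ofFinite (A ⧸ A₀)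
  set D : B ⧸ S := ∏ q : A ⧸ A₀, (c q.out : B ⧸ S) with hD
  have hDa : ∀ a, D = ψ a D * (c a : B ⧸ S) ^ A₀.index := by
    intro a
    have h1 := Equiv.prod_comp (MulAction.toPerm a : Equiv.Perm (A ⧸ A₀))
      (fun q => (c q.out : B ⧸ S))
    simp only [MulAction.toPerm_apply, ← hcong, hcoc, Finset.prod_mul_distrib, Finset.prod_const,
      Finset.card_univ] at h1
    rw [hD, map_prod, Subgroup.index, Nat.card_eq_fintype_card]
    exact h1.symm
  have hpow' : ∀ b : B ⧸ S, b ^ m = 1 := by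
    intro b
    induction b using QuotientGroup.induction_on with
    | _ b =>
      rw [← QuotientGroup.mk_pow, ← QuotientGroup.mk_one, hmk, hpow, one_smul]
  have hbez : ∀ b : B ⧸ S, (b ^ A₀.index) ^ (m.gcdB A₀.index) = b := by
    intro b
    conv_rhs => rw [← zpow_one b, ← Nat.cast_one, ← hm.gcd_eq_one, Nat.gcd_eq_gcd_ab, zpow_add,
      zpow_mul, zpow_natCast, hpow', one_zpow, one_mul, zpow_mul, zpow_natCast]
  obtain ⟨d, hd⟩ := QuotientGroup.mk_surjective (D ^ (m.gcdB A₀.index))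
  refine ⟨d, fun a => ?_⟩
  rw [hφ, ← hc, smul_smul, ← hmk, QuotientGroup.mk_mul, ← hψ, hd, map_zpow]
  conv_rhs => rw [hDa a, mul_zpow, hbez]

variable {G : Type*} [Group G] [Finite G]

/-- Between two normal subgroups `N < R` with `G ⧸ N` solvable there is a normal subgroup `K` such
that `K ⧸ N` is a nontrivial elementary abelian `p`-group. -/
theorem exists_elementary_step {N R : Subgroup G} [N.Normal] (hR : R.Normal)
    [Group.IsSolvable (G ⧸ N)] (hNR : N < R) :
    ∃ (p : ℕ) (K : Subgroup G), p.Prime ∧ K.Normal ∧ N < K ∧ K ≤ R ∧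
      (∀ x ∈ K, ∀ y ∈ K, ⁅x, y⁆ ∈ N) ∧ ∀ x ∈ K, x ^ p ∈ N := by
  let f := QuotientGroup.mk' N
  have hf : Function.Surjective f := QuotientGroup.mk'_surjective N
  have hmem : ∀ x, f x = 1 ↔ x ∈ N := fun x => QuotientGroup.eq_one_iff x
  have hRn : (R.map f).Normal := hR.map f hf
  have hR1 : R.map f ≠ ⊥ := by
    intro h
    refine hNR.not_ge fun x hx => ?_
    have : f x ∈ R.map f := ⟨x, hx, rfl⟩
    rw [h, Subgroup.mem_bot, hmem] at this
    exact this
  obtain ⟨E, hE⟩ := (Set.toFinite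
    {E : Subgroup (G ⧸ N) | E.Normal ∧ E ≠ ⊥ ∧ E ≤ R.map f}).exists_minimal
    ⟨R.map f, hRn, hR1, le_rfl⟩
  obtain ⟨hEn, hE1, hER⟩ := hE.1
  have hEc : ⁅E, E⁆ = ⊥ := by
    by_contra h
    have hlt := Group.IsSolvable.commutator_lt_of_ne_bot hE1
    exact hlt.not_ge (hE.2 ⟨inferInstance, h, hlt.le.trans hER⟩ hlt.le)
  have hcomm : ∀ x ∈ E, ∀ y ∈ E, x * y = y * x := by
    intro x hx y hy
    have : ⁅x, y⁆ ∈ ⁅E, E⁆ := Subgroup.commutator_mem_commutator hx hy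
    rw [hEc, Subgroup.mem_bot] at this
    exact commutatorElement_eq_one_iff_mul_comm.1 this
  have : Nontrivial E := (Subgroup.nontrivial_iff_ne_bot E).2 hE1
  have hcard : Nat.card E ≠ 1 := fun h =>
    not_subsingleton E (Nat.card_eq_one_iff_unique.1 h).1
  obtain ⟨p, hp, hpE⟩ := Nat.exists_prime_and_dvd hcard
  have : Fact p.Prime := ⟨hp⟩
  obtain ⟨z, hz⟩ := exists_prime_orderOf_dvd_card' p hpE
  have hz1 : z ^ p = 1 := by rw [← hz]; exact pow_orderOf_eq_one z
  have hz0 : z ≠ 1 := by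
    rintro rfl
    rw [orderOf_one] at hz
    exact hp.one_lt.ne hz
  let F : Subgroup (G ⧸ N) :=
    { carrier := {x | x ∈ E ∧ x ^ p = 1}
      one_mem' := ⟨one_mem _, one_pow p⟩
      mul_mem' := fun {x y} hx hy => ⟨mul_mem hx.1 hy.1, by
        rw [(show Commute x y from hcomm x hx.1 y hy.1).mul_pow, hx.2, hy.2, one_mul]⟩
      inv_mem' := fun {x} hx => ⟨inv_mem hx.1, by rw [inv_pow, hx.2, inv_one]⟩ }
  have hFn : F.Normal := ⟨fun x hx g => ⟨hEn.conj_mem x hx.1 g, by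
    rw [conj_pow, hx.2, mul_one, mul_inv_cancel]⟩⟩
  refine ⟨p, F.comap f, hp, inferInstance, ?_, ?_, ?_, ?_⟩
  · rw [lt_iff_le_and_ne]
    refine ⟨fun x hx => ?_, fun heq => ?_⟩
    · rw [Subgroup.mem_comap, (hmem x).2 hx]
      exact one_mem _
    · obtain ⟨x, hx⟩ := hf z.1
      have hxF : x ∈ F.comap f := by
        rw [Subgroup.mem_comap, hx]
        exact ⟨z.2, by simpa using congrArg Subtype.val hz1⟩
      rw [← heq, ← hmem, hx] at hxF
      exact hz0 (Subtype.ext hxF)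
  · intro x hx
    obtain ⟨r, hr, hrx⟩ := hER hx.1
    have : r⁻¹ * x ∈ N := by rw [← hmem, map_mul, map_inv, hrx, inv_mul_cancel]
    simpa using mul_mem hr (hNR.le this)
  · intro x hx y hy
    rw [← hmem, map_commutatorElement]
    exact commutatorElement_eq_one_iff_mul_comm.2 (hcomm _ hx.1 _ hy.1)
  · intro x hx
    rw [← hmem, map_pow]
    exact hx.2

theorem exists_relIndex_eq_pow {N K : Subgroup G} [N.Normal] {p : ℕ} (hp : p.Prime)
    (hpow : ∀ x ∈ K, x ^ p ∈ N) : ∃ j, N.relIndex K = p ^ j := by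
  have : Fact p.Prime := ⟨hp⟩
  refine IsPGroup.exists_card_eq (G := K ⧸ N.subgroupOf K) fun q => ⟨1, ?_⟩
  induction q using QuotientGroup.induction_on with
  | _ x =>
    rw [pow_one, ← QuotientGroup.mk_pow, QuotientGroup.eq_one_iff]
    exact hpow x x.2

/-- A normal `p`-section is covered by every subgroup of index prime to `p`. -/
theorem le_of_not_dvd_index {N K T : Subgroup G} [N.Normal] (hK : K.Normal) {p : ℕ} (hp : p.Prime)
    (hpow : ∀ x ∈ K, x ^ p ∈ N) (hNT : N ≤ T) (hT : ¬ p ∣ T.index) : K ≤ T := by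
  obtain ⟨j, hj⟩ := exists_relIndex_eq_pow hp hpow
  have h1 : T.relIndex K ∣ p ^ j := hj ▸ Subgroup.relIndex_dvd_of_le_left K hNT
  have h2 : T.relIndex K ∣ T.index := by
    have e1 := Subgroup.relIndex_mul_index (inf_le_right : T ⊓ K ≤ K)
    have e2 := Subgroup.relIndex_mul_index (inf_le_left : T ⊓ K ≤ T)
    have e3 := Subgroup.relIndex_mul_index (le_sup_right : K ≤ T ⊔ K)
    rw [Subgroup.inf_relIndex_right] at e1
    rw [Subgroup.inf_relIndex_left, ← Subgroup.relIndex_sup_right, ← e1, ← e3] at e2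
    have h0 : K.relIndex (T ⊔ K) ≠ 0 := Subgroup.index_ne_zero_of_finite
    refine ⟨(T ⊔ K).index, Nat.eq_of_mul_eq_mul_left (Nat.pos_of_ne_zero h0) ?_⟩
    rw [e2]
    ring
  obtain ⟨l, -, hl⟩ := (Nat.dvd_prime_pow hp).1 h1
  rw [← Subgroup.relIndex_eq_one, hl]
  rcases Nat.eq_zero_or_pos l with rfl | hpos
  · simp
  · exact absurd ((dvd_pow_self p hpos.ne').trans (hl ▸ h2)) hT

theorem pow_relIndex_mem {G : Type*} [Group G] {M A : Subgroup G} [M.Normal] {x : G} (hx : x ∈ A) :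
    x ^ M.relIndex A ∈ M :=
  (M.subgroupOf A).pow_index_mem ⟨x, hx⟩

theorem isSolvable_quotient_of_le {G : Type*} [Group G] {M K : Subgroup G} [M.Normal] [K.Normal]
    [Group.IsSolvable (G ⧸ M)] (h : M ≤ K) : Group.IsSolvable (G ⧸ K) :=
  Group.isSolvable_of_surjective (f := QuotientGroup.map M K (MonoidHom.id G) h)
    (QuotientGroup.map_surjective_of_surjective _ _ _ (QuotientGroup.mk_surjective) _)

/-- A subgroup `A` which is a `π`-group modulo `M` is conjugate to a subgroup of every `T ≥ M` of
`π'`-index, provided that `G ⧸ M` is solvable. -/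
theorem exists_conj_mem (π : Set ℕ) (M T A : Subgroup G) [hM : M.Normal]
    [hsol : Group.IsSolvable (G ⧸ M)] (hMT : M ≤ T)
    (hT : ∀ p : ℕ, p.Prime → p ∣ T.index → p ∉ π)
    (hA : ∀ p : ℕ, p.Prime → p ∣ M.relIndex A → p ∈ π) :
    ∃ g : G, ∀ a ∈ A, g⁻¹ * a * g ∈ T := by
  induction hd : M.index using Nat.strong_induction_on generalizing M T with
  | _ d ih =>
  subst hd
  by_cases htop : M = ⊤
  · exact ⟨1, fun a _ => hMT (htop ▸ trivial)⟩
  obtain ⟨p, K, hp, hK, hMK, -, hcomm, hpow⟩ :=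
    exists_elementary_step (N := M) (R := ⊤) inferInstance (lt_top_iff_ne_top.2 htop)
  have hsolK : Group.IsSolvable (G ⧸ K) := isSolvable_quotient_of_le hMK.le
  obtain ⟨g, hg⟩ := ih _ (Subgroup.index_strictAnti hMK) K (T ⊔ K) le_sup_right
    (fun q hq hqd => hT q hq (hqd.trans (Subgroup.index_dvd_of_le le_sup_left)))
    (fun q hq hqd => hA q hq (hqd.trans (Subgroup.relIndex_dvd_of_le_left A hMK.le))) rfl
  by_cases hpπ : p ∈ π
  · have hKT : K ≤ T := le_of_not_dvd_index hK hp hpow hMT fun h => hT p hp h hpπ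
    rw [sup_eq_left.2 hKT] at hg
    exact ⟨g, hg⟩
  -- For `p ∉ π` the group `A` permutes the cosets of `T` in `K * g * T`, on which `K` is transitive.
  obtain ⟨d, hd⟩ := exists_smul_fixed (A := A) (B := K) (Y := G ⧸ T)
    (fun a => (MulAut.conjNormal (a : G) : K ≃* K).toMonoidHom)
    (fun a b y => by
      change (a : G) • (b : G) • y = ((a : G) * b * (a : G)⁻¹) • (a : G) • y
      simp [smul_smul]) (g : G ⧸ T)
    (fun a => by
      obtain ⟨k, hk, t, ht, hkt⟩ : ∃ k ∈ K, ∃ t ∈ T, k * t = g⁻¹ * a * g := by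
        have := hg a a.2
        rw [sup_comm, Subgroup.mem_sup_of_normal_left] at this
        obtain ⟨k, hk, t, ht, h⟩ := this
        exact ⟨k, hk, t, ht, h⟩
      refine ⟨⟨g * k * g⁻¹, hK.conj_mem k hk g⟩, ?_⟩
      change ((g * k * g⁻¹ * g : G) : G ⧸ T) = ((a * g : G) : G ⧸ T)
      rw [QuotientGroup.eq]
      have : (g * k * g⁻¹ * g)⁻¹ * (a * g) = t := by
        have h1 : (a : G) = g * (k * t) * g⁻¹ := by rw [hkt]; group
        rw [h1]
        group
      rwa [this])
    (by
      rw [commutator_def, Subgroup.commutator_le]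
      intro x _ y _
      change ((⁅(x : G), (y : G)⁆ * g : G) : G ⧸ T) = (g : G ⧸ T)
      rw [eq_comm, QuotientGroup.eq, ← mul_assoc]
      have := hM.conj_mem _ (hcomm x x.2 y y.2) g⁻¹
      rw [inv_inv] at this
      exact hMT this)
    (M.subgroupOf A)
    (fun a ha => by
      change ((a * g : G) : G ⧸ T) = (g : G ⧸ T)
      rw [eq_comm, QuotientGroup.eq, ← mul_assoc]
      have := hM.conj_mem _ (show (a : G) ∈ M from ha) g⁻¹
      rw [inv_inv] at this
      exact hMT this)
    (m := p) ((Nat.Prime.coprime_iff_not_dvd hp).2 fun h => hpπ (hA p hp h))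
    (fun b => by
      change (((b : G) ^ p * g : G) : G ⧸ T) = (g : G ⧸ T)
      rw [eq_comm, QuotientGroup.eq, ← mul_assoc]
      have := hM.conj_mem _ (hpow b b.2) g⁻¹
      rw [inv_inv] at this
      exact hMT this)
  refine ⟨d * g, fun a ha => ?_⟩
  have h1 : ((d * g : G) : G ⧸ T) = ((a * (d * g) : G) : G ⧸ T) := (hd ⟨a, ha⟩).symm
  rw [QuotientGroup.eq, ← mul_assoc] at h1
  exact h1

/-- Averaging over the cosets of a subgroup which fixes `c` gives a fixed element, on which the
homomorphisms constant on the orbit of `c` are known. -/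
theorem exists_smul_eq_and_map_eq_pow {A C : Type*} [Group A] [CommGroup C]
    [MulDistribMulAction A C] (A₀ : Subgroup A) [A₀.FiniteIndex] (c : C)
    (h₀ : ∀ a ∈ A₀, a • c = c) :
    ∃ e : C, (∀ a : A, a • e = e) ∧ ∀ {D : Type*} [CommGroup D] (f : C →* D),
      (∀ a : A, f (a • c) = f c) → f e = f c ^ A₀.index := by
  have := Fintype.ofFinite (A ⧸ A₀)
  let F : A ⧸ A₀ → C := Quotient.lift (fun a : A => a • c) fun a b hab => by
    have h1 := h₀ _ (QuotientGroup.leftRel_apply.1 hab)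
    rw [mul_smul, inv_smul_eq_iff] at h1
    exact h1.symm
  have hF : ∀ (a : A) q, F (a • q) = a • F q := fun a q => by
    induction q using QuotientGroup.induction_on with
    | _ b => exact mul_smul a b c
  refine ⟨∏ q, F q, fun a => ?_, fun {D} _ f hf => ?_⟩
  · rw [Finset.smul_prod']
    simp only [← hF]
    exact Equiv.prod_comp (MulAction.toPerm a : Equiv.Perm (A ⧸ A₀)) F
  · rw [map_prod, Finset.prod_congr rfl (g := fun _ => f c) fun q _ => ?_, Finset.prod_const,
      Finset.card_univ, Subgroup.index, Nat.card_eq_fintype_card]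
    induction q using QuotientGroup.induction_on with
    | _ b => exact hf b

end Group

/-! ### Extension of invariant representations -/

section Extension

/-- Consequence of the Schur–Zassenhaus theorem: a surjection `pr : E →* L` whose kernel has
exponent prime to the index of `K` splits, compatibly with a given partial splitting over the normal
subgroup `K`. -/
theorem exists_section {E L K : Type*} [Group E] [Finite E] [Group L] [Group K] (pr : E →* L)
    (hpr : Function.Surjective pr) (i : K →* L) (hi : Function.Injective i) (j : K →* E)
    (hpj : ∀ k, pr (j k) = i k) (hj : j.range.Normal) {n : ℕ} (hker : ∀ e ∈ pr.ker, e ^ n = 1)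
    (hn : n.Coprime i.range.index) :
    ∃ s : L →* E, (∀ l, pr (s l) = l) ∧ ∀ k, s (i k) = j k := by
  let q := QuotientGroup.mk' j.range
  have hq : Function.Surjective q := QuotientGroup.mk'_surjective _
  have hqj : ∀ e, q e = 1 ↔ ∃ k, j k = e := fun e => QuotientGroup.eq_one_iff e
  have hZ : (pr.ker.map q).Normal := Subgroup.Normal.map inferInstance q hq
  have hidx : (pr.ker.map q).index = i.range.index := by
    have h1 : i.range = j.range.map pr := by
      rw [MonoidHom.map_range]
      congr 1
      ext k
      exact (hpj k).symm
    rw [Subgroup.index_map, MonoidHom.range_eq_top.2 hq, Subgroup.index_top, mul_one,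
      QuotientGroup.ker_mk', h1, ← Subgroup.index_comap_of_surjective _ hpr,
      Subgroup.comap_map_eq, sup_comm]
  have hcop : (Nat.card (pr.ker.map q)).Coprime (pr.ker.map q).index := by
    rw [hidx]
    refine Nat.coprime_of_dvd fun r hr hrZ hri => ?_
    have : Fact r.Prime := ⟨hr⟩
    obtain ⟨z, hz⟩ := exists_prime_orderOf_dvd_card' r hrZ
    obtain ⟨e, he, hez⟩ := z.2
    have hzn : z ^ n = 1 := Subtype.ext (by
      change (z : E ⧸ j.range) ^ n = 1
      rw [← hez, ← map_pow, hker e he, map_one])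
    have := orderOf_dvd_of_pow_eq_one hzn
    rw [hz] at this
    exact Nat.not_coprime_of_dvd_of_dvd hr.one_lt this hri hn
  obtain ⟨C, hC⟩ := Subgroup.exists_right_complement'_of_coprime hcop
  let S := C.comap q
  have hjS : ∀ k, j k ∈ S := fun k => by
    change q (j k) ∈ C
    rw [(hqj _).2 ⟨k, rfl⟩]
    exact one_mem _
  have hinj : Function.Injective (pr.comp S.subtype) := by
    rw [injective_iff_map_eq_one]
    rintro ⟨e, heS⟩ he
    have he' : pr e = 1 := he
    have h1 : q e ∈ pr.ker.map q ⊓ C := ⟨⟨e, he', rfl⟩, heS⟩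
    rw [hC.disjoint.eq_bot, Subgroup.mem_bot, hqj] at h1
    obtain ⟨k, rfl⟩ := h1
    rw [hpj] at he'
    have : k = 1 := hi (he'.trans (map_one i).symm)
    subst this
    exact Subtype.ext (map_one j)
  have hsurj : Function.Surjective (pr.comp S.subtype) := by
    intro l
    obtain ⟨e, rfl⟩ := hpr l
    have h1 : q e ∈ (pr.ker.map q) ⊔ C := hC.sup_eq_top ▸ trivial
    rw [Subgroup.mem_sup_of_normal_left] at h1
    obtain ⟨_, ⟨z, hz, rfl⟩, y, hy, hzy⟩ := h1
    refine ⟨⟨z⁻¹ * e, ?_⟩, ?_⟩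
    · change q (z⁻¹ * e) ∈ C
      rw [map_mul, map_inv, ← hzy, inv_mul_cancel_left]
      exact hy
    · change pr (z⁻¹ * e) = pr e
      rw [map_mul, map_inv, show pr z = 1 from hz, inv_one, one_mul]
  let F := MulEquiv.ofBijective (pr.comp S.subtype) ⟨hinj, hsurj⟩
  have hF : ∀ l, pr.comp S.subtype (F.symm l) = l := fun l => F.apply_symm_apply l
  refine ⟨S.subtype.comp F.symm.toMonoidHom, hF, fun k => ?_⟩
  have : F.symm (i k) = ⟨j k, hjS k⟩ := hinj ((hF _).trans (hpj k).symm)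
  exact congrArg Subtype.val this

variable {N L : Type*} [Group N] [Group L] {V : Type*} [AddCommGroup V] [Module ℂ V]
  [FiniteDimensional ℂ V]

theorem exists_smul_and_det_eq_pow_of_commute {ρ : Representation ℂ N V} (hρ : ρ.IsIrreducible)
    {T : V →ₗ[ℂ] V}
    (hT : ∀ n v, T (ρ n v) = ρ n (T v)) :
    ∃ z : ℂ, T = z • LinearMap.id ∧ LinearMap.det T = z ^ Module.finrank ℂ V := by
  obtain ⟨z, hz⟩ := exists_smul_of_commute hρ T hT
  refine ⟨z, hz, ?_⟩
  rw [hz, LinearMap.det_smul, LinearMap.det_id, mul_one]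

variable (i : N →* L) (c : L →* MulAut N) (hic : ∀ l n, i (c l n) = l * i n * l⁻¹)

include hic in
/-- An invariant irreducible representation of a normal subgroup extends, provided that its degree
and the order of its determinant are prime to the index. The extension is found among the pairs of a
group element and an operator implementing it, with determinant an `m`-th root of unity. -/
theorem exists_extension [Finite L] (hi : Function.Injective i) {ρ : Representation ℂ N V}
    (hρ : ρ.IsIrreducible) (hinv : ∀ l, ∃ T : V ≃ₗ[ℂ] V, ∀ n v, T (ρ n v) = ρ (c l n) (T v))
    {m : ℕ} (hm : 0 < m) (hdet : ∀ n, LinearMap.det (ρ n) ^ m = 1)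
    (hcop : (m * Module.finrank ℂ V).Coprime i.range.index) :
    ∃ σ : Representation ℂ L V, (∀ n, σ (i n) = ρ n) ∧ ∀ l, LinearMap.det (σ l) ^ m = 1 := by
  have hV := ((isIrreducible_iff ρ).1 hρ).1
  have hd : 0 < Module.finrank ℂ V := Module.finrank_pos
  let R := ρ.asGroupHom
  let δ : (V →ₗ[ℂ] V)ˣ →* ℂˣ := Units.map (LinearMap.det : (V →ₗ[ℂ] V) →* ℂ)
  -- The pairs `(l, T)` with `T` implementing `c l`: an extension of `L` by a group of roots of unity.
  let E : Subgroup (L × (V →ₗ[ℂ] V)ˣ) :=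
    { carrier := {x | (∀ n, x.2 * R n = R (c x.1 n) * x.2) ∧ δ x.2 ^ m = 1}
      one_mem' := ⟨fun n => by simp, by simp⟩
      mul_mem' := fun {x y} hx hy => ⟨fun n => by
        rw [Prod.snd_mul, Prod.fst_mul, mul_assoc, hy.1, ← mul_assoc, hx.1, map_mul,
          MulAut.mul_apply, mul_assoc], by rw [Prod.snd_mul, map_mul, mul_pow, hx.2, hy.2, one_mul]⟩
      inv_mem' := fun {x} hx => ⟨fun n => by
        rw [Prod.snd_inv, Prod.fst_inv, inv_mul_eq_iff_eq_mul, ← mul_assoc, hx.1,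
          ← MulAut.mul_apply, ← map_mul]
        simp, by
        rw [Prod.snd_inv, map_inv, inv_pow, hx.2, inv_one]⟩ }
  let pr : E →* L := (MonoidHom.fst _ _).comp E.subtype
  have hkerE : ∀ e ∈ pr.ker, ∃ z : ℂ, ((e.1.2 : (V →ₗ[ℂ] V)ˣ) : V →ₗ[ℂ] V) = z • LinearMap.id ∧
      z ^ (m * Module.finrank ℂ V) = 1 := by
    intro e he
    have he1 : e.1.1 = 1 := he
    obtain ⟨z, hz, hzd⟩ := exists_smul_and_det_eq_pow_of_commute hρ (T := e.1.2) fun n v => by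
      have := e.2.1 n
      rw [he1, map_one, MulAut.one_apply] at this
      exact LinearMap.congr_fun (congrArg Units.val this) v
    refine ⟨z, hz, ?_⟩
    have := congrArg Units.val e.2.2
    change LinearMap.det (e.1.2 : V →ₗ[ℂ] V) ^ m = 1 at this
    rw [mul_comm, pow_mul, ← hzd, this]
  have hkerfin : Finite pr.ker := by
    have hfin : {z : ℂ | z ^ (m * Module.finrank ℂ V) = 1}.Finite := by
      refine (Polynomial.nthRootsFinset (m * Module.finrank ℂ V) (1 : ℂ)).finite_toSet.subset ?_
      intro z hz
      exact (Polynomial.mem_nthRootsFinset (Nat.mul_pos hm hd) _).2 hz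
    have := hfin.to_subtype
    choose! z hz hz1 using hkerE
    refine Finite.of_injective
      (fun e : pr.ker => (⟨z e.1, hz1 e.1 e.2⟩ : {z : ℂ | z ^ (m * Module.finrank ℂ V) = 1}))
      fun e e' h => ?_
    have h1 : z e.1 = z e'.1 := congrArg Subtype.val h
    have h2 : e.1.1.1 = e'.1.1.1 := (show e.1.1.1 = 1 from e.2).trans
      (show e'.1.1.1 = 1 from e'.2).symm
    refine Subtype.ext (Subtype.ext (Prod.ext h2 (Units.ext ?_)))
    rw [hz e.1 e.2, hz e'.1 e'.2, h1]
  have hEfin : Finite E := by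
    have : Finite (E ⧸ pr.ker) := Finite.of_injective _ (QuotientGroup.kerLift_injective pr)
    exact Finite.of_equiv _ (Subgroup.groupEquivQuotientProdSubgroup (s := pr.ker)).symm
  have hpr : Function.Surjective pr := by
    intro l
    obtain ⟨T, hT⟩ := hinv l
    -- Rescale `T` to have determinant `1`.
    obtain ⟨w, hw⟩ := IsAlgClosed.exists_pow_nat_eq
      ((LinearEquiv.det T : ℂˣ)⁻¹ : ℂˣ).val hd
    have hw0 : w ≠ 0 := by
      rintro rfl
      rw [zero_pow hd.ne'] at hw
      exact Units.ne_zero _ hw.symm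
    let T' := (LinearEquiv.smulOfNeZero ℂ V w hw0).trans T
    let u : (V →ₗ[ℂ] V)ˣ := (LinearMap.GeneralLinearGroup.generalLinearEquiv ℂ V).symm T'
    have hu : ∀ v, (u : V →ₗ[ℂ] V) v = T (w • v) := fun v => rfl
    have hu' : (u : V →ₗ[ℂ] V) = w • (T : V →ₗ[ℂ] V) := by
      ext v
      rw [hu, map_smul]
      rfl
    refine ⟨⟨(l, u), fun n => Units.ext (LinearMap.ext fun v => ?_), Units.ext ?_⟩, rfl⟩
    · change (u : V →ₗ[ℂ] V) (ρ n v) = ρ (c l n) ((u : V →ₗ[ℂ] V) v)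
      rw [hu, hu, ← map_smul, hT]
    · change LinearMap.det (u : V →ₗ[ℂ] V) ^ m = 1
      rw [hu', LinearMap.det_smul, hw, ← LinearEquiv.coe_det, Units.inv_mul, one_pow]
  let j : N →* E := (i.prod R).codRestrict E fun n => ⟨fun n' => by
    change R n * R n' = R (c (i n) n') * R n
    have : c (i n) n' = n * n' * n⁻¹ := hi (by rw [hic]; simp)
    rw [this, map_mul, map_mul, map_inv, inv_mul_cancel_right], Units.ext (hdet n)⟩
  have hj : j.range.Normal := by
    refine ⟨?_⟩
    rintro _ ⟨n, rfl⟩ e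
    refine ⟨c e.1.1 n, Subtype.ext (Prod.ext (hic _ _) ?_)⟩
    change R (c e.1.1 n) = e.1.2 * R n * e.1.2⁻¹
    rw [e.2.1, mul_inv_cancel_right]
  obtain ⟨s, hs, hsj⟩ := exists_section pr hpr i hi j (fun k => rfl) hj
    (fun e he => by
      obtain ⟨z, hz, hz1⟩ := hkerE e he
      refine Subtype.ext (Prod.ext ?_ (Units.ext ?_))
      · change e.1.1 ^ _ = 1
        rw [show e.1.1 = 1 from he, one_pow]
      · change (e.1.2 : V →ₗ[ℂ] V) ^ _ = 1
        rw [hz, smul_pow, hz1]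
        exact (one_smul _ _).trans (one_pow _)) hcop
  refine ⟨(Units.coeHom _).comp ((MonoidHom.snd _ _).comp (E.subtype.comp s)), fun n => ?_,
    fun l => ?_⟩
  · change ((s (i n)).1.2 : V →ₗ[ℂ] V) = ρ n
    rw [hsj]
    rfl
  · exact congrArg Units.val (s l).2.2

/-- The extension with determinant of prescribed order is unique. -/
theorem extension_unique {ρ : Representation ℂ N V} (hρ : ρ.IsIrreducible) {m : ℕ}
    (hn : i.range.Normal) (hcop : (m * Module.finrank ℂ V).Coprime i.range.index)
    (hic : ∀ l n, i (c l n) = l * i n * l⁻¹)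
    {σ τ : Representation ℂ L V} (hσ : ∀ n, σ (i n) = ρ n) (hτ : ∀ n, τ (i n) = ρ n)
    (hσd : ∀ l, LinearMap.det (σ l) ^ m = 1) (hτd : ∀ l, LinearMap.det (τ l) ^ m = 1) : σ = τ := by
  have hV := ((isIrreducible_iff ρ).1 hρ).1
  ext l : 1
  have hstep : ∀ (κ : Representation ℂ L V), (∀ n, κ (i n) = ρ n) →
      ∀ n, κ l * ρ n = ρ (c l n) * κ l := by
    intro κ hκ n
    rw [← hκ, ← hκ, hic, ← map_mul, ← map_mul, inv_mul_cancel_right]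
  have hinv : τ l⁻¹ * τ l = 1 := by rw [← map_mul, inv_mul_cancel, map_one]
  have hinv' : τ l * τ l⁻¹ = 1 := by rw [← map_mul, mul_inv_cancel, map_one]
  obtain ⟨z, hz, hzd⟩ := exists_smul_and_det_eq_pow_of_commute hρ (T := τ l⁻¹ * σ l) fun n v => by
    have h1 : τ l⁻¹ * σ l * ρ n = ρ n * (τ l⁻¹ * σ l) := by
      have h2 : τ l⁻¹ * ρ (c l n) = ρ n * τ l⁻¹ := by
        calc τ l⁻¹ * ρ (c l n) = τ l⁻¹ * (ρ (c l n) * τ l) * τ l⁻¹ := by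
              rw [mul_assoc, mul_assoc, hinv', mul_one]
          _ = _ := by rw [← hstep τ hτ, ← mul_assoc, hinv, one_mul]
      rw [mul_assoc, hstep σ hσ, ← mul_assoc, h2, mul_assoc]
    exact LinearMap.congr_fun h1 v
  have hσz : σ l = z • τ l := by
    have : τ l * (τ l⁻¹ * σ l) = τ l * (z • LinearMap.id) := by rw [hz]
    rw [← mul_assoc, hinv', one_mul, mul_smul_comm] at this
    rw [this]
    rfl
  have hz1 : z ^ (m * Module.finrank ℂ V) = 1 := by
    have h1 := hσd l
    rw [hσz, LinearMap.det_smul, mul_pow, hτd, mul_one] at h1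
    rwa [mul_comm, pow_mul]
  have hz2 : z ^ i.range.index = 1 := by
    obtain ⟨n, hn'⟩ := i.range.pow_index_mem l
    have h1 : σ l ^ i.range.index = τ l ^ i.range.index := by
      rw [← map_pow, ← map_pow, ← hn', hσ, hτ]
    have h2 : LinearMap.det (τ l) ≠ 0 := by
      have := congrArg LinearMap.det hinv'
      rw [map_mul, map_one] at this
      exact left_ne_zero_of_mul_eq_one this
    rw [hσz, smul_pow] at h1
    have h3 : (τ l⁻¹) ^ i.range.index * τ l ^ i.range.index = 1 := by
      rw [← map_pow, ← map_pow, ← map_mul, inv_pow, inv_mul_cancel, map_one]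
    have h4 := congrArg (fun T => (τ l⁻¹) ^ i.range.index * T) h1
    simp only [mul_smul_comm, h3] at h4
    have : Nontrivial (V →ₗ[ℂ] V) := inferInstance
    have h5 : (z ^ i.range.index - 1) • (1 : V →ₗ[ℂ] V) = 0 := by
      rw [sub_smul, one_smul, h4, sub_self]
    rcases smul_eq_zero.1 h5 with h | h
    · exact sub_eq_zero.1 h
    · exact absurd h one_ne_zero
  have hz3 : z = 1 := by
    have h1 := orderOf_dvd_of_pow_eq_one hz1
    have h2 := orderOf_dvd_of_pow_eq_one hz2
    exact orderOf_eq_one_iff.1 (Nat.eq_one_of_dvd_coprimes hcop h1 h2)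
  rw [hσz, hz3, one_smul]

end Extension

/-! ### Invariant characters along an elementary abelian section -/

section Steps

variable {G : Type*} [Group G]

/-- The conjugation action of a subgroup `K` on a normal subgroup `N`. -/
def conjHom (K N : Subgroup G) [N.Normal] : K →* MulAut N := MulAut.conjNormal.comp K.subtype

theorem inclusion_conjHom {N K : Subgroup G} [N.Normal] (h : N ≤ K) (l : K) (n : N) :
    Subgroup.inclusion h (conjHom K N l n) = l * Subgroup.inclusion h n * l⁻¹ :=
  Subtype.ext (by simp [conjHom, MulAut.conjNormal_apply])

theorem mem_range_inclusion {N K : Subgroup G} (h : N ≤ K) (x : K) :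
    x ∈ (Subgroup.inclusion h).range ↔ (x : G) ∈ N := by
  rw [Subgroup.inclusion_range, Subgroup.mem_subgroupOf]

theorem commutator_le_range_inclusion {N K : Subgroup G} (h : N ≤ K)
    (hcomm : ∀ x ∈ K, ∀ y ∈ K, ⁅x, y⁆ ∈ N) : commutator K ≤ (Subgroup.inclusion h).range := by
  rw [commutator_def, Subgroup.commutator_le]
  intro x _ y _
  rw [mem_range_inclusion]
  exact hcomm x x.2 y y.2

/-- Multiplication of class functions by the linear characters of a quotient. -/
@[reducible] def linAction {N L : Type*} [Group N] [Group L] (i : N →* L) :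
    MulAction (linTriv i) (L → ℂ) where
  smul lam f := fun x => (lam.1 x : ℂ) * f x
  one_smul f := funext fun x => by
    change (((1 : linTriv i).1 x : ℂˣ) : ℂ) * f x = f x
    simp
  mul_smul a b f := funext fun x => by
    change (((a * b : linTriv i).1 x : ℂˣ) : ℂ) * f x = a.1 x * (b.1 x * f x)
    simp [mul_assoc]

theorem sup_le_inertia {H N : Subgroup G} [N.Normal] {θ : N → ℂ} (hθ : θ ∈ Irr N)
    (hfix : FixedBy H N θ) : N ⊔ H ≤ inertia MulAut.conjNormal θ := by
  refine sup_le (fun x hx n => ?_) fun h hh n => hfix h hh n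
  have : MulAut.conjNormal x n = ⟨x, hx⟩ * n * ⟨x, hx⟩⁻¹ := Subtype.ext (by simp)
  rw [this, irr_conj hθ]

variable [Finite G]

/-- Going up a section `K ⧸ N` of order prime to `H ⧸ M`: an `H`-invariant irreducible character of
`N` lies under an `H`-invariant irreducible character of `K`. The group `H` permutes the irreducible
characters of `K` over it, on which the linear characters of `K ⧸ N` act transitively, so
Glauberman's lemma provides a fixed point. -/
theorem exists_fixedBy_over {M H N K : Subgroup G} [M.Normal] [N.Normal] [K.Normal] (hMN : M ≤ N)
    (hNK : N ≤ K) {p : ℕ} (hp : p.Prime) (hcomm : ∀ x ∈ K, ∀ y ∈ K, ⁅x, y⁆ ∈ N)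
    (hpow : ∀ x ∈ K, x ^ p ∈ N) (hpH : ¬ p ∣ M.relIndex H) {ψ : N → ℂ} (hψ : ψ ∈ Irr N)
    (hfix : FixedBy H N ψ) :
    ∃ φ ∈ Irr K, ip (fun n => φ (Subgroup.inclusion hNK n)) ψ ≠ 0 ∧ FixedBy H K φ := by
  let i := Subgroup.inclusion hNK
  have hi : Function.Injective i := Subgroup.inclusion_injective hNK
  have hic := inclusion_conjHom hNK
  have hc := commutator_le_range_inclusion hNK hcomm
  obtain ⟨φ₀, hφ₀, hφψ⟩ := exists_irr_over i hi hψ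
  let cH : H →* MulAut K := conjHom H K
  let _ := conjAction cH
  let _ := linAction i
  let Φ : H → linTriv i →* linTriv i := fun h =>
    { toFun := fun lam => ⟨lam.1.comp (cH h⁻¹ : K ≃* K).toMonoidHom, fun n => by
        have : cH h⁻¹ (i n) = i (conjHom H N h⁻¹ n) := rfl
        change lam.1 (cH h⁻¹ (i n)) = 1
        rw [this]
        exact lam.2 _⟩
      map_one' := rfl
      map_mul' := fun _ _ => rfl }
  obtain ⟨d, hd⟩ := exists_smul_fixed (A := H) (B := linTriv i) (Y := K → ℂ) Φ
    (fun h lam f => rfl) φ₀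
    (fun h => by
      obtain ⟨lam, hlam, heq⟩ := exists_linTriv_mul_eq i (conjHom K N) hic hi hc hφ₀
        (irr_comp_mulEquiv (cH h⁻¹) hφ₀) hψ hφψ (by
          have h1 : (fun n => φ₀ (cH h⁻¹ (i n))) = fun n => φ₀ (i (conjHom H N h⁻¹ n)) := rfl
          have h2 : ψ = fun n => ψ (conjHom H N h⁻¹ n) :=
            funext fun n => (hfix _ (inv_mem h.2) n).symm
          rw [h1, h2, ip_comp_mulEquiv (conjHom H N h⁻¹) (fun n => φ₀ (i n)) ψ]
          exact hφψ)
      exact ⟨⟨lam, hlam⟩, heq.symm⟩)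
    (by
      rw [commutator_def, Subgroup.commutator_le]
      intro x _ y _
      rw [commutatorElement_eq_one_iff_mul_comm.2 (mul_comm x y)]
      exact one_mem _)
    (M.subgroupOf H)
    (fun a ha => by
      have haM : (a : G)⁻¹ ∈ M := inv_mem ha
      funext k
      change φ₀ (cH a⁻¹ k) = φ₀ k
      have : cH a⁻¹ k = ⟨(a : G)⁻¹, hNK (hMN haM)⟩ * k * ⟨(a : G)⁻¹, hNK (hMN haM)⟩⁻¹ :=
        Subtype.ext (by simp [cH, conjHom])
      rw [this, irr_conj hφ₀])
    (m := p) ((Nat.Prime.coprime_iff_not_dvd hp).2 hpH)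
    (fun lam => by
      funext k
      change (((lam ^ p : linTriv i).1 k : ℂˣ) : ℂ) * φ₀ k = φ₀ k
      have h1 : (lam ^ p : linTriv i).1 k = 1 := by
        obtain ⟨n, hn⟩ := (mem_range_inclusion hNK (k ^ p)).2 (hpow k k.2)
        change (lam.1 ^ p) k = 1
        rw [MonoidHom.pow_apply, ← map_pow, ← hn]
        exact lam.2 n
      rw [h1, Units.val_one, one_mul])
  refine ⟨fun k => (d.1 k : ℂ) * φ₀ k, irr_mul_linear hφ₀ d.1, ?_, fun h hh k => ?_⟩
  · have h1 : (fun n => (d.1 (i n) : ℂ) * φ₀ (i n)) = fun n => φ₀ (i n) := by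
      funext n
      rw [d.2 n, Units.val_one, one_mul]
    change ip (fun n => (d.1 (i n) : ℂ) * φ₀ (i n)) ψ ≠ 0
    rw [h1]
    exact hφψ
  · have h1 := congrFun (hd (⟨h, hh⟩ : H)⁻¹) k
    change (d.1 (cH (⟨h, hh⟩ : H)⁻¹⁻¹ k) : ℂ) * φ₀ (cH (⟨h, hh⟩ : H)⁻¹⁻¹ k) = _ at h1
    rw [inv_inv] at h1
    exact h1

/-- Going up a `p`-section `K ⧸ N` covered by `H`: an `H`-invariant irreducible character of `N` of
degree prime to `p` gives rise to an `H`-invariant irreducible character of `K` of the same degree.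
A power of the determinant is used to twist the given character so that its determinant gets order
prime to `p`; then it has a canonical extension to `K`. -/
theorem exists_fixedBy_degree_eq {H N K : Subgroup G} [N.Normal] [K.Normal]
    (hNK : N ≤ K) {p : ℕ} (hp : p.Prime) (hpow : ∀ x ∈ K, x ^ p ∈ N) (hKH : K ≤ N ⊔ H)
    {ψ : N → ℂ} (hψ : ψ ∈ Irr N) (hfix : FixedBy H N ψ) {d : ℕ} (hd : ψ 1 = d) (hpd : ¬ p ∣ d) :
    ∃ φ ∈ Irr K, φ 1 = d ∧ FixedBy H K φ := by
  let i := Subgroup.inclusion hNK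
  have hi : Function.Injective i := Subgroup.inclusion_injective hNK
  have hic := inclusion_conjHom hNK
  have hirange : i.range = N.subgroupOf K := Subgroup.inclusion_range hNK
  have hin : i.range.Normal := hirange ▸ inferInstance
  obtain ⟨n, ρ, hρ, rfl⟩ := hψ
  have hdn : Module.finrank ℂ (Fin n → ℂ) = d := by
    rw [char_one] at hd
    exact_mod_cast hd
  let δ : N →* ℂˣ := (Units.map (LinearMap.det : (_ →ₗ[ℂ] _) →* ℂ)).comp ρ.asGroupHom
  have hδ : ∀ x, (δ x : ℂ) = LinearMap.det (ρ x) := fun x => rfl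
  have hδfix : ∀ h ∈ H, ∀ x : N, δ (MulAut.conjNormal h x) = δ x := by
    intro h hh x
    obtain ⟨T, hT⟩ := exists_linearEquiv_of_comp_eq hρ (MulAut.conjNormal h) (hfix h hh)
    refine Units.ext ?_
    rw [hδ, hδ, ← LinearMap.det_conj (ρ x) T]
    congr 1
    refine LinearMap.ext fun v => ?_
    change ρ (MulAut.conjNormal h x) v = T (ρ x (T.symm v))
    rw [hT, T.apply_symm_apply]
  -- `|N| = p ^ a * b` with `p ∤ b`. For `1 = d * u + p ^ a * v`, the twist of `ρ` by `δ ^ (-u)` has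
  -- determinant `δ ^ (1 - d * u) = δ ^ (p ^ a * v)`, which is killed by `b`.
  obtain ⟨a, b, hb, hab⟩ := Nat.exists_eq_pow_mul_and_not_dvd (n := Nat.card N) Nat.card_pos.ne' p
    hp.ne_one
  have hdp : d.Coprime (p ^ a) := ((Nat.Prime.coprime_iff_not_dvd hp).2 hpd).symm.pow_right a
  have hbez : (1 : ℤ) = d * d.gcdA (p ^ a) + (p ^ a : ℕ) * d.gcdB (p ^ a) := by
    rw [← Nat.gcd_eq_gcd_ab, hdp.gcd_eq_one, Nat.cast_one]
  set u := d.gcdA (p ^ a)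
  set v := d.gcdB (p ^ a)
  let ρ' := twist (δ ^ (-u)) ρ
  have hρ' : ρ'.IsIrreducible := isIrreducible_twist _ hρ
  have hdet : ∀ x, LinearMap.det (ρ' x) ^ b = 1 := by
    intro x
    have h1 : LinearMap.det (ρ' x) = ((δ x ^ ((p ^ a : ℕ) * v) : ℂˣ) : ℂ) := by
      rw [twist_apply, LinearMap.det_smul, hdn, ← hδ, MonoidHom.zpow_apply, ← Units.val_pow_eq_pow_val,
        ← Units.val_mul, ← zpow_natCast, ← zpow_mul, ← zpow_add_one]
      congr 2
      linear_combination hbez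
    have h2 : (p ^ a : ℕ) * v * (b : ℕ) = (Nat.card N : ℤ) * v := by
      rw [hab]
      push_cast
      ring
    rw [h1, ← Units.val_pow_eq_pow_val, ← zpow_natCast, ← zpow_mul, h2, zpow_mul, zpow_natCast,
      ← map_pow, pow_card_eq_one', map_one, one_zpow, Units.val_one]
  have hb0 : 0 < b := Nat.pos_of_ne_zero fun h => hb (h ▸ dvd_zero p)
  have hχ' : FixedBy H N ρ'.character := by
    intro h hh x
    rw [twist_character]
    change ((δ ^ (-u)) (MulAut.conjNormal h x) : ℂ) * ρ.character (MulAut.conjNormal h x) =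
      ((δ ^ (-u)) x : ℂ) * ρ.character x
    rw [hfix h hh, MonoidHom.zpow_apply, hδfix h hh, MonoidHom.zpow_apply]
  have hinertia := sup_le_inertia (character_mem_irr hρ') hχ'
  have hcop : (b * Module.finrank ℂ (Fin n → ℂ)).Coprime i.range.index := by
    obtain ⟨j, hj⟩ := exists_relIndex_eq_pow hp hpow
    have : i.range.index = p ^ j := by rw [hirange]; exact hj
    rw [this, hdn]
    refine Nat.Coprime.pow_right _ (Nat.Coprime.symm ((Nat.Prime.coprime_iff_not_dvd hp).2 ?_))
    rw [hp.dvd_mul, not_or]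
    exact ⟨hb, hpd⟩
  obtain ⟨σ, hσ, hσd⟩ := exists_extension i (conjHom K N) hic hi hρ'
    (fun l => exists_linearEquiv_of_comp_eq hρ' (conjHom K N l) (hinertia (hKH l.2)))
    hb0 hdet hcop
  have hσirr : σ.IsIrreducible := by
    refine isIrreducible_of_comp i ?_
    have : pullback i σ = ρ' := MonoidHom.ext hσ
    rwa [this]
  refine ⟨σ.character, character_mem_irr hσirr, by rw [char_one, hdn], fun h hh k => ?_⟩
  obtain ⟨T, hT⟩ := exists_linearEquiv_of_comp_eq hρ' (MulAut.conjNormal h) (hχ' h hh)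
  -- The conjugate of `σ` by `h`, transported back along `T`, is another extension of `ρ'`.
  let τ : Representation ℂ K (Fin n → ℂ) :=
    (T.symm.conjAlgEquiv ℂ : _ →* _).comp (pullback (MulAut.conjNormal h : K ≃* K).toMonoidHom σ)
  have hτ : ∀ k, τ k = (T.symm : _ →ₗ[ℂ] _) ∘ₗ σ (MulAut.conjNormal h k) ∘ₗ (T : _ →ₗ[ℂ] _) :=
    fun k => rfl
  have heq : τ = σ := by
    refine extension_unique i (conjHom K N) hρ' hin hcop hic (fun x => ?_) hσ (fun l => ?_) hσd
    · have h1 : MulAut.conjNormal h (i x) = i (MulAut.conjNormal h x) := rfl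
      rw [hτ, h1, hσ]
      refine LinearMap.ext fun w => ?_
      change T.symm (ρ' (MulAut.conjNormal h x) (T w)) = ρ' x w
      rw [← hT, T.symm_apply_apply]
    · rw [hτ, ← hσd (MulAut.conjNormal h l)]
      congr 1
      exact LinearMap.det_conj _ T.symm
  have h1 : σ.character k = τ.character k := by rw [heq]
  rw [h1, character, character, hτ]
  exact (LinearMap.trace_conj' (σ (MulAut.conjNormal h k)) T.symm).symm

end Steps

/-! ### Groups all of whose characters of `π'`-degree are linear -/

section HallModulo

variable {G : Type*} [Group G]

/-- `H` contains the normal subgroup `M`, the quotient `G ⧸ M` is solvable, and `H ⧸ M` is a Hall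
`π`-subgroup of it. -/
structure IsHallModulo (π : Set ℕ) (M H : Subgroup G) [M.Normal] : Prop where
  prime : ∀ p ∈ π, p.Prime
  le : M ≤ H
  solvable : Group.IsSolvable (G ⧸ M)
  mem : ∀ p : ℕ, p.Prime → p ∣ M.relIndex H → p ∈ π
  notMem : ∀ p : ℕ, p.Prime → p ∣ H.index → p ∉ π

variable {π : Set ℕ}

theorem linear_mem_irrPrime (hπ : ∀ p ∈ π, p.Prime) {N : Type*} [Group N] (μ : N →* ℂˣ) :
    (fun n => (μ n : ℂ)) ∈ IrrPrime π N :=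
  ⟨linear_mem_irr μ, 1, by simp, fun p hp h => (hπ p hp).one_lt.ne' (Nat.dvd_one.1 h)⟩

/-- Linear characters of `N` and of `H` which agree on `N ⊓ H` have a common extension to `N ⊔ H`,
if the first one is `H`-invariant. -/
theorem exists_hom_sup {N H : Subgroup G} [N.Normal] (μ : N →* ℂˣ) (lam : H →* ℂˣ)
    (hfix : ∀ h ∈ H, ∀ n, μ (MulAut.conjNormal h n) = μ n)
    (hagree : ∀ x (hN : x ∈ N) (hx : x ∈ H), μ ⟨x, hN⟩ = lam ⟨x, hx⟩) :
    ∃ ν : (N ⊔ H : Subgroup G) →* ℂˣ, ∀ (n : N) (h : H) (hx : (n * h : G) ∈ N ⊔ H),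
      ν ⟨n * h, hx⟩ = μ n * lam h := by
  have hdec : ∀ x : (N ⊔ H : Subgroup G), ∃ (n : N) (h : H), (n * h : G) = x := by
    rintro ⟨x, hx⟩
    rw [Subgroup.mem_sup_of_normal_left] at hx
    obtain ⟨n, hn, h, hh, rfl⟩ := hx
    exact ⟨⟨n, hn⟩, ⟨h, hh⟩, rfl⟩
  have hwd : ∀ (n n' : N) (h h' : H), (n * h : G) = n' * h' → μ n * lam h = μ n' * lam h' := by
    intro n n' h h' heq
    have h1 : ((n' : G)⁻¹ * n : G) = h' * (h : G)⁻¹ := by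
      rw [inv_mul_eq_iff_eq_mul, ← mul_assoc, ← heq, mul_inv_cancel_right]
    have h2 := hagree ((n' : G)⁻¹ * n : G) (mul_mem (inv_mem n'.2) n.2)
      (h1 ▸ mul_mem h'.2 (inv_mem h.2))
    have h3 : (⟨((n' : G)⁻¹ * n : G), mul_mem (inv_mem n'.2) n.2⟩ : N) = n'⁻¹ * n := rfl
    have h4 : (⟨((n' : G)⁻¹ * n : G), h1 ▸ mul_mem h'.2 (inv_mem h.2)⟩ : H) = h' * h⁻¹ := Subtype.ext h1
    rw [h3, h4, map_mul, map_inv, map_mul, map_inv, inv_mul_eq_iff_eq_mul, ← mul_assoc,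
      eq_mul_inv_iff_mul_eq] at h2
    exact h2
  choose n h hnh using hdec
  refine ⟨MonoidHom.mk' (fun x => μ (n x) * lam (h x)) fun x y => ?_, fun m k hx => ?_⟩
  · have h1 := hwd (n (x * y)) (n x * MulAut.conjNormal (h x : G) (n y)) (h (x * y)) (h x * h y) (by
      rw [hnh]
      simp only [Subgroup.coe_mul, MulAut.conjNormal_apply, ← hnh x, ← hnh y]
      group)
    rw [h1, map_mul, map_mul, hfix _ (h x).2]
    exact mul_mul_mul_comm _ _ _ _
  · exact hwd _ _ _ _ (hnh _)

/-- The action of a group on the linear characters of a group it acts on. -/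
@[reducible] def homAction {A K : Type*} [Group A] [Group K] (c : A →* MulAut K) :
    MulDistribMulAction A (K →* ℂˣ) where
  smul a lam := lam.comp (c a⁻¹ : K ≃* K).toMonoidHom
  one_smul lam := MonoidHom.ext fun k => by
    change lam (c 1⁻¹ k) = lam k
    simp
  mul_smul a b lam := MonoidHom.ext fun k => by
    change lam (c (a * b)⁻¹ k) = lam (c b⁻¹ (c a⁻¹ k))
    simp
  smul_mul _ _ _ := rfl
  smul_one _ := rfl

variable {M H : Subgroup G} [M.Normal]

namespace IsHallModulo

theorem not_dvd_relIndex (hH : IsHallModulo π M H) {p : ℕ} (hp : p.Prime) (hpπ : p ∉ π) :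
    ¬ p ∣ M.relIndex H := fun h => hpπ (hH.mem p hp h)

theorem coprime (hH : IsHallModulo π M H) : (M.relIndex H).Coprime H.index :=
  Nat.coprime_of_dvd fun q hq h1 h2 => hH.notMem q hq h2 (hH.mem q hq h1)

/-- An element of `H` which is a `p`-element modulo `N` for some `p ∉ π` lies in `N`. -/
theorem mem_of_pow_mem (hH : IsHallModulo π M H) {N : Subgroup G} (hMN : M ≤ N) {p : ℕ}
    (hp : p.Prime) (hpπ : p ∉ π) {x : G} (hx : x ∈ H) (hxp : x ^ p ∈ N) : x ∈ N :=
  mem_of_pow_mem_of_coprime ((Nat.Prime.coprime_iff_not_dvd hp).2 (hH.not_dvd_relIndex hp hpπ)) hxp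
    (hMN (pow_relIndex_mem hx))

variable [Finite G]

/-- The next elementary abelian factor above `N` in a chain of normal subgroups from `M` to `R`. -/
theorem exists_step (hH : IsHallModulo π M H) {N R : Subgroup G} [N.Normal] (hR : R.Normal)
    (hMN : M ≤ N) (hNR : N < R) :
    ∃ (p : ℕ) (K : Subgroup G), p.Prime ∧ K.Normal ∧ N < K ∧ K ≤ R ∧
      (∀ x ∈ K, ∀ y ∈ K, ⁅x, y⁆ ∈ N) ∧ ∀ x ∈ K, x ^ p ∈ N :=
  have := hH.solvable
  have := isSolvable_quotient_of_le hMN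
  exists_elementary_step hR hNR

/-- A `p`-factor with `p ∈ π` is covered by the Hall subgroup. -/
theorem le_sup (hH : IsHallModulo π M H) {N K : Subgroup G} [N.Normal] (hK : K.Normal) {p : ℕ}
    (hp : p.Prime) (hpow : ∀ x ∈ K, x ^ p ∈ N) (hpπ : p ∈ π) : K ≤ N ⊔ H :=
  le_of_not_dvd_index hK hp hpow le_sup_left fun h =>
    hH.notMem p hp (h.trans (Subgroup.index_dvd_of_le le_sup_right)) hpπ

/-- Going up a section of order prime to `π` among the `H`-invariant characters of `π'`-degree. -/
theorem exists_irrPrime_over (hH : IsHallModulo π M H) {N K : Subgroup G} [N.Normal] [K.Normal]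
    (hMN : M ≤ N) (hNK : N ≤ K) {p : ℕ} (hp : p.Prime) (hcomm : ∀ x ∈ K, ∀ y ∈ K, ⁅x, y⁆ ∈ N)
    (hpow : ∀ x ∈ K, x ^ p ∈ N) (hpπ : p ∉ π) {ψ : N → ℂ} (hψ : ψ ∈ IrrPrime π N)
    (hfix : FixedBy H N ψ) :
    ∃ φ ∈ IrrPrime π K, ip (fun n => φ (Subgroup.inclusion hNK n)) ψ ≠ 0 ∧ FixedBy H K φ := by
  obtain ⟨φ, hφ, hφψ, hφfix⟩ := exists_fixedBy_over hMN hNK hp hcomm hpow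
    (hH.not_dvd_relIndex hp hpπ) hψ.1 hfix
  obtain ⟨d, hd, hdπ⟩ := hψ.2
  obtain ⟨a, -, ha⟩ := irr_apply_one hφ
  refine ⟨φ, ⟨hφ, a, ha, fun q hq hqa => hdπ q hq ?_⟩, hφψ, hφfix⟩
  exact dvd_degree_of_dvd_degree (Subgroup.inclusion hNK) (conjHom K N) (inclusion_conjHom hNK)
    (Subgroup.inclusion_injective hNK) (commutator_le_range_inclusion hNK hcomm) hp
    (fun x => (mem_range_inclusion hNK _).2 (hpow x x.2)) hφ hψ.1 hφψ ha hd (hH.prime q hq)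
    (fun h => hpπ (h ▸ hq)) hqa

/-- If all irreducible characters of `G` of `π'`-degree are linear, then so are the `H`-invariant
ones of every normal subgroup containing `M`. -/
theorem apply_one_eq_one_of_fixedBy (hH : IsHallModulo π M H) (hG : IrrPrime π G = Lin G)
    (N : Subgroup G) [N.Normal] (hMN : M ≤ N) {ψ : N → ℂ} (hψ : ψ ∈ IrrPrime π N)
    (hfix : FixedBy H N ψ) : ψ 1 = 1 := by
  induction hd : N.index using Nat.strong_induction_on generalizing N with
  | _ d ih =>
  subst hd
  by_cases htop : N = ⊤
  · subst htop
    have h1 : (fun g => ψ (Subgroup.topEquiv.symm g)) ∈ IrrPrime π G :=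
      ⟨irr_comp_mulEquiv Subgroup.topEquiv.symm hψ.1, by simpa using hψ.2⟩
    rw [hG] at h1
    simpa using h1.2
  obtain ⟨p, K, hp, hK, hNK, -, hcomm, hpow⟩ :=
    hH.exists_step (R := ⊤) inferInstance hMN (lt_top_iff_ne_top.2 htop)
  obtain ⟨d, hd, hdπ⟩ := hψ.2
  by_cases hpπ : p ∈ π
  · obtain ⟨φ, hφ, hφ1, hφfix⟩ := exists_fixedBy_degree_eq hNK.le hp hpow
      (hH.le_sup hK hp hpow hpπ) hψ.1 hfix hd (hdπ p hpπ)
    rw [hd, ← hφ1]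
    exact ih _ (Subgroup.index_strictAnti hNK) K (hMN.trans hNK.le) ⟨hφ, d, hφ1, hdπ⟩ hφfix rfl
  · obtain ⟨φ, hφ, hφψ, hφfix⟩ :=
      hH.exists_irrPrime_over hMN hNK.le hp hcomm hpow hpπ hψ hfix
    have h1 := ih _ (Subgroup.index_strictAnti hNK) K (hMN.trans hNK.le) hφ hφfix rfl
    obtain ⟨m, -, hm⟩ := exists_nat_degree_eq (Subgroup.inclusion hNK.le) (conjHom K N)
      (inclusion_conjHom hNK.le) hφ.1 hψ.1 hφψ (a := 1) (by rw [h1, Nat.cast_one]) hd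
    rw [hd, Nat.eq_one_of_mul_eq_one_left hm.symm, Nat.cast_one]

/-- If all irreducible characters of `G` of `π'`-degree are linear, then a linear character of `H`
and a compatible `H`-invariant linear character of a normal subgroup `N ≥ M` have a common
extension to `G`. -/
theorem exists_common_extension (hH : IsHallModulo π M H) (hG : IrrPrime π G = Lin G)
    (lam : H →* ℂˣ) (N : Subgroup G) [N.Normal] (hMN : M ≤ N) (μ : N →* ℂˣ)
    (hfix : ∀ h ∈ H, ∀ n, μ (MulAut.conjNormal h n) = μ n)
    (hagree : ∀ x (hN : x ∈ N) (hx : x ∈ H), μ ⟨x, hN⟩ = lam ⟨x, hx⟩) :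
    ∃ ν : G →* ℂˣ, (∀ n : N, ν n = μ n) ∧ ∀ h : H, ν h = lam h := by
  induction hd : N.index using Nat.strong_induction_on generalizing N with
  | _ d ih =>
  subst hd
  by_cases htop : N = ⊤
  · subst htop
    exact ⟨μ.comp (Subgroup.topEquiv.symm : G ≃* (⊤ : Subgroup G)).toMonoidHom,
      fun n => rfl, fun h => hagree h trivial h.2⟩
  obtain ⟨p, K, hp, hK, hNK, -, hcomm, hpow⟩ :=
    hH.exists_step (R := ⊤) inferInstance hMN (lt_top_iff_ne_top.2 htop)
  suffices h : ∃ μ' : K →* ℂˣ, (∀ n : N, μ' (Subgroup.inclusion hNK.le n) = μ n) ∧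
      (∀ h ∈ H, ∀ k, μ' (MulAut.conjNormal h k) = μ' k) ∧
      ∀ x (hK : x ∈ K) (hx : x ∈ H), μ' ⟨x, hK⟩ = lam ⟨x, hx⟩ by
    obtain ⟨μ', h1, h2, h3⟩ := h
    obtain ⟨ν, hν, hνH⟩ :=
      ih _ (Subgroup.index_strictAnti hNK) K (hMN.trans hNK.le) μ' h2 h3 rfl
    exact ⟨ν, fun n => (hν (Subgroup.inclusion hNK.le n)).trans (h1 n), hνH⟩
  by_cases hpπ : p ∈ π
  · have hKH := hH.le_sup hK hp hpow hpπ
    obtain ⟨ν, hν⟩ := exists_hom_sup μ lam hfix hagree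
    refine ⟨ν.comp (Subgroup.inclusion hKH), fun n => ?_, fun h hh k => ?_, fun x hxK hx => ?_⟩
    · have h1 : Subgroup.inclusion hKH (Subgroup.inclusion hNK.le n) =
          ⟨n * (1 : H), mul_mem (Subgroup.mem_sup_left n.2) (one_mem _)⟩ := Subtype.ext (by simp)
      rw [MonoidHom.comp_apply, h1, hν, map_one, mul_one]
    · have h1 : Subgroup.inclusion hKH (MulAut.conjNormal h k) =
          ⟨h, Subgroup.mem_sup_right hh⟩ * Subgroup.inclusion hKH k *
            ⟨h, Subgroup.mem_sup_right hh⟩⁻¹ := Subtype.ext (by simp)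
      rw [MonoidHom.comp_apply, h1, map_mul, map_mul, map_inv, mul_inv_cancel_comm,
        MonoidHom.comp_apply]
    · have h1 : Subgroup.inclusion hKH ⟨x, hxK⟩ =
          ⟨(1 : N) * (⟨x, hx⟩ : H), mul_mem (one_mem _) (Subgroup.mem_sup_right hx)⟩ :=
        Subtype.ext (by simp)
      rw [MonoidHom.comp_apply, h1, hν, map_one, one_mul]
  · obtain ⟨φ, hφ, hφμ, hφfix⟩ := hH.exists_irrPrime_over hMN hNK.le hp hcomm hpow hpπ
      (linear_mem_irrPrime hH.prime μ) (fun h hh n => by rw [hfix h hh])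
    obtain ⟨μ', hμ'⟩ := exists_hom_of_apply_one hφ.1
      (hH.apply_one_eq_one_of_fixedBy hG K (hMN.trans hNK.le) hφ hφfix)
    have hext : ∀ n : N, μ' (Subgroup.inclusion hNK.le n) = μ n := by
      simp only [hμ'] at hφμ
      have := eq_of_ip_ne_zero (linear_mem_irr (μ'.comp (Subgroup.inclusion hNK.le)))
        (linear_mem_irr μ) hφμ
      exact fun n => Units.ext (congrFun this n)
    refine ⟨μ', hext, fun h hh k => Units.ext ?_, fun x hxK hx => ?_⟩
    · rw [← hμ', ← hμ', hφfix h hh]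
    · have hxN := hH.mem_of_pow_mem hMN hp hpπ hx (hpow x hxK)
      rw [← hagree x hxN hx, ← hext]
      rfl

/-- If all irreducible characters of `G` of `π'`-degree are linear, then `H ⊓ G' ≤ H'`: the linear
characters of `H` extend to `G`. -/
theorem mem_commutator_of_mem (hH : IsHallModulo π M H) (hG : IrrPrime π G = Lin G)
    (hM : M ≤ ⁅H, H⁆) {x : G} (hx : x ∈ H) (hxG : x ∈ commutator G) : x ∈ ⁅H, H⁆ := by
  by_contra hxH
  rw [← Subgroup.map_subtype_commutator] at hxH hM
  obtain ⟨lam, hlam, hlamx⟩ := exists_hom_apply_ne_one (le_refl (commutator H)) (x := ⟨x, hx⟩)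
    fun h => hxH ⟨_, h, rfl⟩
  obtain ⟨ν, -, hν⟩ := hH.exists_common_extension hG lam M le_rfl 1 (fun _ _ _ => rfl)
    (fun y hy hyH => by
      obtain ⟨z, hz, hzy⟩ := hM hy
      have : (⟨y, hyH⟩ : H) = z := Subtype.ext hzy.symm
      rw [this, hlam z hz, MonoidHom.one_apply])
  have h1 : ν x = 1 := Abelianization.commutator_subset_ker ν hxG
  exact hlamx ((hν ⟨x, hx⟩).symm.trans h1)

/-- If all irreducible characters of `G` of `π'`-degree are linear, then `N_G(H) ⊓ G' ≤ H`. If `x`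
normalizes `H` but its `π'`-part `y` modulo `M` is nontrivial, then some linear character of `G` which
is trivial on `H` is not `1` at `y`. -/
theorem mem_of_mem_normalizer (hH : IsHallModulo π M H) (hG : IrrPrime π G = Lin G) {x : G}
    (hx : x ∈ Subgroup.normalizer (H : Set G)) (hxG : x ∈ commutator G) : x ∈ H := by
  set y := x ^ M.relIndex H with hy
  by_cases hyM : y ∈ M
  · have h1 : x ^ H.relIndex (Subgroup.normalizer (H : Set G)) ∈ H :=
      (H.subgroupOf (Subgroup.normalizer (H : Set G))).pow_index_mem ⟨x, hx⟩
    have h2 : H.relIndex (Subgroup.normalizer (H : Set G)) ∣ H.index :=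
      Subgroup.relIndex_dvd_index_of_le Subgroup.le_normalizer
    exact mem_of_pow_mem_of_coprime (hH.coprime.coprime_dvd_right h2) (hH.le hyM) h1
  exfalso
  -- `N` is the last term of the chain which does not contain `y`.
  obtain ⟨N, hN⟩ := (Set.toFinite {N : Subgroup G | N.Normal ∧ M ≤ N ∧ y ∉ N}).exists_maximal
    ⟨M, inferInstance, le_rfl, hyM⟩
  obtain ⟨hNn, hMN, hyN⟩ := hN.1
  obtain ⟨p, K, hp, hK, hNK, -, hcomm, hpow⟩ := hH.exists_step (R := ⊤) inferInstance hMN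
    (lt_top_iff_ne_top.2 fun h => hyN (h ▸ trivial))
  have hyK : y ∈ K := by
    by_contra h
    exact hNK.not_ge (hN.2 ⟨hK, hMN.trans hNK.le, h⟩ hNK.le)
  by_cases hpπ : p ∈ π
  · have h1 : y ^ H.index ∈ M := by
      rw [hy, ← pow_mul, Subgroup.relIndex_mul_index hH.le]
      exact M.pow_index_mem x
    exact hyN (mem_of_pow_mem_of_coprime
      ((Nat.Prime.coprime_iff_not_dvd hp).2 fun h => hH.notMem p hp h hpπ) (hpow y hyK) (hMN h1))
  -- `y` commutes with `H` modulo `N`, since `H ⊓ K ≤ N`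
  have hyc : ∀ h ∈ H, h * y * h⁻¹ * y⁻¹ ∈ N := by
    intro h hh
    have hyH : y ∈ Subgroup.normalizer (H : Set G) := pow_mem hx _
    have h1 : h * y * h⁻¹ * y⁻¹ ∈ H := by
      have := (Subgroup.mem_normalizer_iff.1 hyH h⁻¹).1 (inv_mem hh)
      have := mul_mem hh this
      simpa [mul_assoc] using this
    have h2 : h * y * h⁻¹ * y⁻¹ ∈ K := mul_mem (hK.conj_mem y hyK h) (inv_mem hyK)
    exact hH.mem_of_pow_mem hMN hp hpπ h1 (hpow _ h2)
  obtain ⟨lam, hlam, hlamy⟩ := exists_hom_apply_ne_one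
    (commutator_le_range_inclusion hNK.le hcomm) (x := ⟨y, hyK⟩)
    (fun h => hyN ((mem_range_inclusion hNK.le _).1 h))
  have hlamN : ∀ (k : K), (k : G) ∈ N → lam k = 1 := fun k hk =>
    hlam k ((mem_range_inclusion hNK.le k).2 hk)
  -- Averaging `lam` over `H ⧸ M` makes it `H`-invariant without losing its value at `y`.
  let _ := homAction (conjHom H K)
  obtain ⟨μ, hμ, hμe⟩ := exists_smul_eq_and_map_eq_pow (M.subgroupOf H) lam (fun a ha => by
    refine MonoidHom.ext fun k => ?_
    change lam (conjHom H K a⁻¹ k) = lam k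
    have haK : (a : G)⁻¹ ∈ K := hNK.le (hMN (inv_mem ha))
    have : conjHom H K a⁻¹ k = ⟨(a : G)⁻¹, haK⟩ * k * ⟨(a : G)⁻¹, haK⟩⁻¹ :=
      Subtype.ext (by simp [conjHom])
    rw [this, map_mul, map_mul, map_inv, mul_inv_cancel_comm])
  have hμN : ∀ (k : K), (k : G) ∈ N → μ k = 1 := fun k hk => by
    have h1 := hμe (MonoidHom.eval k) fun a => by
      change lam (conjHom H K a⁻¹ k) = lam k
      rw [hlamN k hk]
      exact hlamN _ (by
        simp only [conjHom, MonoidHom.comp_apply, MulAut.conjNormal_apply]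
        exact hNn.conj_mem _ hk _)
    rw [MonoidHom.eval_apply_apply, MonoidHom.eval_apply_apply, hlamN k hk, one_pow] at h1
    exact h1
  have hμy : μ ⟨y, hyK⟩ ≠ 1 := by
    have h1 := hμe (MonoidHom.eval ⟨y, hyK⟩) fun a => by
      change lam (conjHom H K a⁻¹ ⟨y, hyK⟩) = lam ⟨y, hyK⟩
      rw [← mul_inv_eq_one, ← map_inv, ← map_mul]
      exact hlamN _ (hyc _ (inv_mem a.2))
    rw [MonoidHom.eval_apply_apply, MonoidHom.eval_apply_apply] at h1
    intro h2
    rw [h1] at h2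
    refine hlamy (orderOf_eq_one_iff.1 (Nat.eq_one_of_dvd_coprimes
      ((Nat.Prime.coprime_iff_not_dvd hp).2 (hH.not_dvd_relIndex hp hpπ))
      (orderOf_dvd_of_pow_eq_one ?_) (orderOf_dvd_of_pow_eq_one h2)))
    rw [← map_pow]
    exact hlamN _ (hpow y hyK)
  obtain ⟨ν, hν, -⟩ := hH.exists_common_extension hG 1 K (hMN.trans hNK.le) μ
    (fun h hh k => by
      have h1 := DFunLike.congr_fun (hμ (⟨h, hh⟩ : H)⁻¹) k
      change μ (conjHom H K (⟨h, hh⟩ : H)⁻¹⁻¹ k) = μ k at h1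
      rw [inv_inv] at h1
      exact h1)
    (fun z hzK hzH => hμN _ (hH.mem_of_pow_mem hMN hp hpπ hzH (hpow z hzK)))
  have h1 : ν y = 1 := Abelianization.commutator_subset_ker ν (pow_mem hxG _)
  exact hμy ((hν ⟨y, hyK⟩).symm.trans h1)

end IsHallModulo

end HallModulo

/-! ### Groups satisfying the local conditions -/

section LinearConstituents

variable {G : Type*} [Group G] {V : Type*} [AddCommGroup V] [Module ℂ V]
  [FiniteDimensional ℂ V]

/-- The vectors on which the subgroup `K` acts through the linear character `ν`. -/
noncomputable def eigenspace {K : Subgroup G} (ρ : Representation ℂ G V) (ν : K →* ℂˣ) :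
    Submodule ℂ V :=
  invariants (twist ν⁻¹ (pullback K.subtype ρ))

omit [FiniteDimensional ℂ V] in
theorem mem_eigenspace {K : Subgroup G} {ρ : Representation ℂ G V} {ν : K →* ℂˣ} {v : V} :
    v ∈ eigenspace ρ ν ↔ ∀ k : K, ρ k v = (ν k : ℂ) • v := by
  refine forall_congr' fun k => ?_
  rw [twist_apply, LinearMap.smul_apply, MonoidHom.inv_apply, ← Units.smul_def, inv_smul_eq_iff]
  rfl

/-- The multiplicity of `ν` in the restriction of a character is the dimension of the eigenspace. -/
theorem finrank_eigenspace [Finite G] {K : Subgroup G} (ρ : Representation ℂ G V) (ν : K →* ℂˣ) :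
    ip (fun k : K => ρ.character k) (fun k => (ν k : ℂ)) =
      Module.finrank ℂ (eigenspace ρ ν) := by
  have := Fintype.ofFinite K
  have : Invertible (Nat.card K : ℂ) := invertibleOfNonzero (Nat.cast_ne_zero.2 Nat.card_pos.ne')
  rw [eigenspace, ← card_inv_mul_sum_char_eq_finrank, ip_eq_sum, twist_character]
  congr 1
  refine Finset.sum_congr rfl fun k _ => ?_
  rw [mul_comm, map_inv]
  rfl

/-- A normal subgroup with a nonzero fixed vector acts trivially in an irreducible representation. -/
theorem eq_one_of_ip_ne_zero [Finite G] {ρ : Representation ℂ G V} (hρ : ρ.IsIrreducible)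
    {N : Subgroup G}
    (hN : N.Normal) (h : ip (fun n : N => ρ.character n) 1 ≠ 0) : ∀ n ∈ N, ρ n = 1 := by
  have h1 : (1 : N → ℂ) = fun n => ((1 : N →* ℂˣ) n : ℂ) := by ext; simp
  rw [h1, finrank_eigenspace] at h
  have hmem : ∀ v, v ∈ eigenspace ρ (1 : N →* ℂˣ) ↔ ∀ n ∈ N, ρ n v = v := fun v => by
    rw [mem_eigenspace]
    simp
  rcases ((isIrreducible_iff ρ).1 hρ).2 (eigenspace ρ (1 : N →* ℂˣ)) (fun g v hv => by
    rw [hmem] at hv ⊢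
    intro n hn
    have h2 : n * g = g * (g⁻¹ * n * g) := by group
    have h3 : g⁻¹ * n * g ∈ N := by simpa using hN.conj_mem n hn g⁻¹
    rw [← Module.End.mul_apply, ← map_mul, h2, map_mul, Module.End.mul_apply, hv _ h3]) with h0 | h0
  · rw [h0, finrank_bot, Nat.cast_zero] at h
    exact absurd rfl h
  · intro n hn
    refine LinearMap.ext fun v => ?_
    exact (hmem v).1 (h0 ▸ trivial) n hn

/-- The determinant of `H` on the eigenspace of an `H`-invariant linear character `ν` of `K` is a
linear character of `H`, hence trivial on `H'`, while on `H ⊓ K` it is a power of `ν`. -/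
theorem pow_finrank_eigenspace_eq_one {H K : Subgroup G} [K.Normal] (ρ : Representation ℂ G V)
    (ν : K →* ℂˣ) (hfix : ∀ h ∈ H, ∀ k, ν (MulAut.conjNormal h k) = ν k) {x : G}
    (hx : x ∈ ⁅H, H⁆) (hxK : x ∈ K) : ν ⟨x, hxK⟩ ^ Module.finrank ℂ (eigenspace ρ ν) = 1 := by
  let S : Subrepresentation (pullback H.subtype ρ) := ⟨eigenspace ρ ν, fun h v hv => by
    rw [mem_eigenspace] at hv ⊢
    intro k
    have h1 : (k : G) * h = h * MulAut.conjNormal (h⁻¹ : G) k := by simp [mul_assoc]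
    change ρ k (ρ h v) = (ν k : ℂ) • ρ h v
    rw [← Module.End.mul_apply, ← map_mul, h1, map_mul, Module.End.mul_apply, hv,
      hfix _ (inv_mem h.2), map_smul]⟩
  let δ : H →* ℂˣ :=
    (Units.map (LinearMap.det : (S.toSubmodule →ₗ[ℂ] S.toSubmodule) →* ℂ)).comp
      S.toRepresentation.asGroupHom
  rw [← Subgroup.map_subtype_commutator] at hx
  obtain ⟨y, hy, rfl⟩ := hx
  have h1 : δ y = 1 := Abelianization.commutator_subset_ker δ hy
  have h2 : S.toRepresentation y = (ν ⟨y, hxK⟩ : ℂ) • LinearMap.id := by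
    refine LinearMap.ext fun v => Subtype.ext ?_
    exact mem_eigenspace.1 v.2 ⟨y, hxK⟩
  refine Units.ext ?_
  have h3 := congrArg Units.val h1
  change LinearMap.det (S.toRepresentation y) = 1 at h3
  rw [h2, LinearMap.det_smul, LinearMap.det_id, mul_one] at h3
  exact h3

end LinearConstituents

section Converse

variable {G : Type*} [Group G] [Finite G] {π : Set ℕ}

/-- The version of `exists_conj_mem` with the conjugating element in a given subgroup `L`. -/
theorem exists_mem_conj_mem (π : Set ℕ) {M T A L : Subgroup G} [M.Normal]
    [Group.IsSolvable (G ⧸ M)] (hMT : M ≤ T) (hAL : A ≤ L)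
    (hT : ∀ p : ℕ, p.Prime → p ∣ T.relIndex L → p ∉ π)
    (hA : ∀ p : ℕ, p.Prime → p ∣ M.relIndex A → p ∈ π) :
    ∃ g ∈ L, ∀ a ∈ A, g⁻¹ * a * g ∈ T := by
  have hsol : Group.IsSolvable (L ⧸ M.subgroupOf L) := by
    have hinj : Function.Injective
        (QuotientGroup.map (M.subgroupOf L) M L.subtype le_rfl) := by
      rw [injective_iff_map_eq_one]
      intro q hq
      induction q using QuotientGroup.induction_on with
      | _ x => exact (QuotientGroup.eq_one_iff x).2 ((QuotientGroup.eq_one_iff (x : G)).1 hq)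
    exact Group.isSolvable_of_isSolvable_injective hinj
  obtain ⟨g, hg⟩ := exists_conj_mem π (M.subgroupOf L) (T.subgroupOf L) (A.subgroupOf L)
    (fun x hx => hMT hx) hT (by rwa [Subgroup.relIndex_subgroupOf hAL])
  exact ⟨g, g.2, fun a ha => hg ⟨a, hAL ha⟩ ha⟩

theorem mem_normalizer_of_conj_mem {H : Subgroup G} {z : G} (h : ∀ x ∈ H, z * x * z⁻¹ ∈ H) :
    z ∈ Subgroup.normalizer (H : Set G) := by
  have h1 : H.map (MulAut.conj z).toMonoidHom = H := by
    refine Subgroup.eq_of_le_of_card_ge ?_ ?_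
    · rintro _ ⟨x, hx, rfl⟩
      exact h x hx
    · exact (Nat.card_congr (H.equivMapOfInjective _ (MulAut.conj z).injective).toEquiv).le
  rw [Subgroup.mem_normalizer_iff]
  refine fun x => ⟨h x, fun hx => ?_⟩
  rw [← h1] at hx
  obtain ⟨y, hy, hyx⟩ := hx
  have : y = x := by
    change z * y * z⁻¹ = z * x * z⁻¹ at hyx
    simpa using hyx
  exact this ▸ hy

variable {M H : Subgroup G} [M.Normal]

namespace IsHallModulo

/-- Below an irreducible character of `π'`-degree there are `H`-invariant constituents, since the
orbit of a constituent has `π'`-length. -/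
theorem exists_fixedBy_conj (hH : IsHallModulo π M H) {N : Subgroup G} [N.Normal] (hMN : M ≤ N)
    {χ : G → ℂ} (hχ : χ ∈ IrrPrime π G) {θ : N → ℂ} (hθ : θ ∈ Irr N)
    (h : ip (fun n : N => χ n) θ ≠ 0) :
    ∃ g : G, (fun n => θ (MulAut.conjNormal g n)) ∈ IrrPrime π N ∧
      FixedBy H N (fun n => θ (MulAut.conjNormal g n)) ∧
      ip (fun n : N => χ n) (fun n => θ (MulAut.conjNormal g n)) ≠ 0 := by
  have hic : ∀ (l : G) (n : N), N.subtype (MulAut.conjNormal l n) = l * N.subtype n * l⁻¹ :=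
    fun l n => MulAut.conjNormal_apply l n
  obtain ⟨a, ha, haπ⟩ := hχ.2
  obtain ⟨b, -, hb⟩ := irr_apply_one hθ
  obtain ⟨m, -, hm⟩ := exists_nat_degree_eq N.subtype MulAut.conjNormal hic hχ.1 hθ h ha hb
  have := hH.solvable
  have hNT : N ≤ inertia MulAut.conjNormal θ :=
    le_sup_left.trans (sup_le_inertia (H := ⊥) hθ fun x hx n => by
      rw [Subgroup.mem_bot.1 hx, map_one, MulAut.one_apply])
  obtain ⟨g, hg⟩ := exists_conj_mem π M (inertia MulAut.conjNormal θ) H (hMN.trans hNT)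
    (fun p _ hpd hpπ => haπ p hpπ (hm ▸ (hpd.mul_left m).mul_right b)) hH.mem
  refine ⟨g⁻¹, ⟨irr_comp_mulEquiv (MulAut.conjNormal g⁻¹) hθ, b, by simpa using hb, fun p hp hpb =>
    haπ p hp (hm ▸ hpb.mul_left _)⟩, fun x hx n => ?_, ?_⟩
  · have h1 := hg x hx (MulAut.conjNormal g⁻¹ n)
    rw [← MulAut.mul_apply, ← map_mul] at h1
    change θ (MulAut.conjNormal g⁻¹ (MulAut.conjNormal x n)) = θ (MulAut.conjNormal g⁻¹ n)
    rw [← MulAut.mul_apply, ← map_mul, ← h1]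
    congr 3
    group
  · have h1 := ip_restrict_conj N.subtype MulAut.conjNormal hic hχ.1 θ g⁻¹
    exact h1 ▸ h

/-- An `H`-invariant linear character of a `π'`-section `K ⧸ N` below `G'` is trivial, if
`N_G(H) ⊓ G' ≤ H'`. Otherwise there would be an `H`-fixed coset outside `N` and, by conjugacy of Hall
subgroups in `N ⊔ H`, such a coset contains an element normalizing `H`. -/
theorem linear_eq_one_of_notMem (hH : IsHallModulo π M H)
    (ha : ∀ x ∈ Subgroup.normalizer (H : Set G), x ∈ commutator G → x ∈ ⁅H, H⁆) {N K : Subgroup G}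
    [hNn : N.Normal] [hKn : K.Normal] (hMN : M ≤ N) (hNK : N ≤ K) (hKG : K ≤ commutator G) {p : ℕ}
    (hp : p.Prime) (hcomm : ∀ x ∈ K, ∀ y ∈ K, ⁅x, y⁆ ∈ N) (hpow : ∀ x ∈ K, x ^ p ∈ N)
    (hpπ : p ∉ π) (ν : K →* ℂˣ) (hν : ∀ k : K, (k : G) ∈ N → ν k = 1)
    (hfix : ∀ h ∈ H, ∀ k, ν (MulAut.conjNormal h k) = ν k) : ν = 1 := by
  by_contra hne
  obtain ⟨y, hy⟩ : ∃ y, ν y ≠ 1 := by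
    by_contra! hc
    exact hne (MonoidHom.ext hc)
  let _ : MulAction H (G ⧸ N) :=
    MulAction.compHom (G ⧸ N) (MulAut.conj.comp ((QuotientGroup.mk' N).comp H.subtype))
  have hsmul : ∀ (h : H) (g : G), h • (g : G ⧸ N) = ((h * g * (h : G)⁻¹ : G) : G ⧸ N) :=
    fun h g => rfl
  have hcoset : ∀ b k : G, b ∈ N → ((b * k : G) : G ⧸ N) = k := fun b k hb => by
    rw [QuotientGroup.mk_mul, (QuotientGroup.eq_one_iff b).2 hb, one_mul]
  -- `H` acts on the coset of `y` modulo `ker ν`, as `ν` is `H`-invariant; it fixes some `d * y * N`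
  -- there, with `ν d = 1`.
  obtain ⟨d, hd⟩ := exists_smul_fixed (A := H) (B := ν.ker) (Y := G ⧸ N)
    (fun h =>
      { toFun := fun b => ⟨MulAut.conjNormal (h : G) b.1, by
          rw [MonoidHom.mem_ker, hfix h h.2]; exact b.2⟩
        map_one' := Subtype.ext (map_one _)
        map_mul' := fun a b => Subtype.ext (map_mul _ _ _) })
    (fun h b q => by
      induction q using QuotientGroup.induction_on with
      | _ g =>
        change ((h * ((b : K) * g) * (h : G)⁻¹ : G) : G ⧸ N) =
          (((MulAut.conjNormal (h : G) (b : K) : K) * (h * g * (h : G)⁻¹) : G) : G ⧸ N)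
        congr 1
        rw [MulAut.conjNormal_apply]
        group) ((y : G) : G ⧸ N)
    (fun h => ⟨⟨MulAut.conjNormal (h : G) y * y⁻¹, by
        rw [MonoidHom.mem_ker, map_mul, hfix h h.2, map_inv, mul_inv_cancel]⟩, by
      rw [hsmul]
      change (((MulAut.conjNormal (h : G) y * y⁻¹ : K) * y : G) : G ⧸ N) = _
      congr 1
      simp⟩)
    (by
      rw [commutator_def, Subgroup.commutator_le]
      intro a _ b _
      exact hcoset _ _ (hcomm a a.1.2 b b.1.2))
    (M.subgroupOf H)
    (fun a haM => by
      rw [hsmul, mul_assoc, hcoset (a : G) _ (hMN haM), QuotientGroup.eq]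
      have h1 : ((y : G) * (a : G)⁻¹)⁻¹ * y = a := by group
      rw [h1]
      exact hMN haM)
    (m := p) ((Nat.Prime.coprime_iff_not_dvd hp).2 (hH.not_dvd_relIndex hp hpπ))
    (fun b => hcoset _ _ (hpow b b.1.2))
  have hxK : (d * y : G) ∈ K := mul_mem d.1.2 y.2
  have hx1 : ν ⟨d * y, hxK⟩ ≠ 1 := by
    have : (⟨d * y, hxK⟩ : K) = d * y := rfl
    rw [this, map_mul, d.2, one_mul]
    exact hy
  have hxH : ∀ h ∈ H, (d * y * h * (d * y : G)⁻¹ : G) * h⁻¹ ∈ N := by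
    intro h hh
    have h1 : ((h * (d * y) * h⁻¹ : G) : G ⧸ N) = ((d * y : G) : G ⧸ N) := hd ⟨h, hh⟩
    rw [eq_comm, ← mul_inv_eq_one, ← QuotientGroup.mk_inv, ← QuotientGroup.mk_mul,
      QuotientGroup.eq_one_iff] at h1
    have : (d * y * h * (d * y : G)⁻¹ : G) * h⁻¹ = (d * y : G) * (h * (d * y) * h⁻¹)⁻¹ := by group
    rwa [this]
  set x : G := d * y with hx
  have := hH.solvable
  -- `H` and its conjugate by `x` lie in `N ⊔ H`, so they are conjugate there, by an element of `N`.
  obtain ⟨g, hg, hgH⟩ := exists_mem_conj_mem π (M := M) (T := H)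
    (A := H.map (MulAut.conj x).toMonoidHom) (L := N ⊔ H) hH.le
    (by
      rintro _ ⟨h, hh, rfl⟩
      have := mul_mem (Subgroup.mem_sup_left (T := H) (hxH h hh))
        (Subgroup.mem_sup_right (S := N) hh)
      simpa using this)
    (fun q hq hqd => hH.notMem q hq
      (hqd.trans (Subgroup.relIndex_dvd_index_of_le le_sup_right)))
    (by
      have hMx : M.map (MulAut.conj x).toMonoidHom = M := Subgroup.Normal.map_conj_eq M x
      have h1 := Subgroup.relIndex_map_map_of_injective M H
        (f := (MulAut.conj x).toMonoidHom) (MulAut.conj x).injective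
      rw [hMx] at h1
      rw [h1]
      exact hH.mem)
  rw [Subgroup.mem_sup_of_normal_left] at hg
  obtain ⟨n, hn, h₀, hh₀, rfl⟩ := hg
  have hzN : n⁻¹ * x ∈ Subgroup.normalizer (H : Set G) := by
    refine mem_normalizer_of_conj_mem fun h hh => ?_
    have h1 := hgH _ ⟨h, hh, rfl⟩
    have h2 := mul_mem (mul_mem hh₀ h1) (inv_mem hh₀)
    have h3 : n⁻¹ * x * h * (n⁻¹ * x)⁻¹ =
        h₀ * ((n * h₀)⁻¹ * (x * h * x⁻¹) * (n * h₀)) * h₀⁻¹ := by group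
    rw [h3]
    exact h2
  have hzK : n⁻¹ * x ∈ K := mul_mem (inv_mem (hNK hn)) hxK
  have hzH : n⁻¹ * x ∈ H := Subgroup.commutator_le_self H (ha _ hzN (hKG hzK))
  have hz := mul_mem hn (hH.mem_of_pow_mem hMN hp hpπ hzH (hpow _ hzK))
  rw [mul_inv_cancel_left] at hz
  exact hx1 (hν _ hz)

/-- An `H`-invariant linear constituent `ν` of a `p`-section `K ⧸ N` below `G'` with `p ∈ π` is trivial,
if `N_G(H) ⊓ G' ≤ H'`. As `K = N (H ⊓ K)`, it is enough to consider elements of `H ⊓ K ≤ H'`, at which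
both the `p`-th power of `ν` and its power to the dimension of the eigenspace are `1`. -/
theorem linear_eq_one_of_mem (hH : IsHallModulo π M H)
    (ha : ∀ x ∈ Subgroup.normalizer (H : Set G), x ∈ commutator G → x ∈ ⁅H, H⁆) {N K : Subgroup G}
    [N.Normal] [hKn : K.Normal] (hNK : N ≤ K) (hKG : K ≤ commutator G) {p : ℕ}
    (hp : p.Prime) (hpow : ∀ x ∈ K, x ^ p ∈ N) (hpπ : p ∈ π) {χ : G → ℂ} (hχ : χ ∈ IrrPrime π G)
    (ν : K →* ℂˣ) (hν : ∀ k : K, (k : G) ∈ N → ν k = 1)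
    (hfix : ∀ h ∈ H, ∀ k, ν (MulAut.conjNormal h k) = ν k)
    (hχν : ip (fun k : K => χ k) (fun k => (ν k : ℂ)) ≠ 0) : ν = 1 := by
  obtain ⟨a, haχ, haπ⟩ := hχ.2
  obtain ⟨m, hm, hma⟩ := exists_nat_degree_eq K.subtype MulAut.conjNormal
    (fun l n => MulAut.conjNormal_apply l n) hχ.1 (linear_mem_irr ν) hχν haχ (b := 1) (by simp)
  obtain ⟨r, ρ, hρ, rfl⟩ := hχ.1
  have hdim : Module.finrank ℂ (eigenspace ρ ν) = m := by
    have := (finrank_eigenspace ρ ν).symm.trans hm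
    exact_mod_cast this
  have hcop : p.Coprime m := (Nat.Prime.coprime_iff_not_dvd hp).2 fun h =>
    haπ p hpπ (by rw [hma, mul_one]; exact h.mul_right _)
  refine MonoidHom.ext fun k => ?_
  have hk := hH.le_sup hKn hp hpow hpπ k.2
  rw [Subgroup.mem_sup_of_normal_left] at hk
  obtain ⟨n, hn, h, hh, hnh⟩ := hk
  have hhK : h ∈ K := by
    have : h = n⁻¹ * k := by rw [← hnh, inv_mul_cancel_left]
    rw [this]
    exact mul_mem (inv_mem (hNK hn)) k.2
  have h1 : k = ⟨n, hNK hn⟩ * ⟨h, hhK⟩ := Subtype.ext hnh.symm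
  have h2 := pow_finrank_eigenspace_eq_one ρ ν hfix
    (ha h (Subgroup.le_normalizer hh) (hKG hhK)) hhK
  have h3 : ν ⟨h, hhK⟩ ^ p = 1 := by
    rw [← map_pow]
    exact hν _ (hpow h hhK)
  rw [hdim] at h2
  rw [h1, map_mul, hν _ hn, one_mul, MonoidHom.one_apply]
  exact orderOf_eq_one_iff.1 (Nat.eq_one_of_dvd_coprimes hcop (orderOf_dvd_of_pow_eq_one h3)
    (orderOf_dvd_of_pow_eq_one h2))

/-- Under the two local conditions, an irreducible character of `π'`-degree is linear: a normal
subgroup maximal among those between `M` and `G'` in the kernel is `G'`. -/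
theorem apply_one_eq_one (hH : IsHallModulo π M H) (hMG : M ≤ commutator G)
    (ha : ∀ x ∈ Subgroup.normalizer (H : Set G), x ∈ commutator G → x ∈ ⁅H, H⁆)
    (hb : ∀ θ ∈ IrrPrime π M, FixedBy H M θ → θ = 1) {χ : G → ℂ} (hχ : χ ∈ IrrPrime π G) :
    χ 1 = 1 := by
  obtain ⟨r, ρ, hρ, hρχ⟩ := hχ.1
  have hχ0 : χ 1 ≠ 0 := by
    obtain ⟨d, hd, hd1⟩ := irr_apply_one hχ.1
    rw [hd1]
    exact Nat.cast_ne_zero.2 hd.ne'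
  have hker : ∀ N : Subgroup G, (∀ n ∈ N, ρ n = 1) → ip (fun n : N => χ n) 1 ≠ 0 := by
    intro N hN
    have h1 : (fun n : N => χ n) = χ 1 • (1 : N → ℂ) := by
      funext n
      simp [hρχ, character, hN n n.2]
    rw [h1, ip_smul_left, ip_self one_mem_irr, mul_one]
    exact hχ0
  have hM : ∀ n ∈ M, ρ n = 1 := by
    obtain ⟨θ, hθ, hθχ⟩ := exists_ip_ne_zero (restrict_mem_closure M.subtype hχ.1)
      fun h => hχ0 (by simpa using congrFun h 1)
    obtain ⟨g, hg1, hg2, hg3⟩ := hH.exists_fixedBy_conj le_rfl hχ hθ hθχ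
    rw [hb _ hg1 hg2, hρχ] at hg3
    exact eq_one_of_ip_ne_zero hρ inferInstance hg3
  obtain ⟨N, hN⟩ := (Set.toFinite {N : Subgroup G | N.Normal ∧ M ≤ N ∧ N ≤ commutator G ∧
    ∀ n ∈ N, ρ n = 1}).exists_maximal ⟨M, inferInstance, le_rfl, hMG, hM⟩
  obtain ⟨hNn, hMN, hNG, hNρ⟩ := hN.1
  rcases hNG.eq_or_lt with hNeq | hlt
  · obtain ⟨lam, -, hlam⟩ := exists_linTriv_ip_ne_zero N.subtype N.subtype_injective
      (by rw [Subgroup.range_subtype, hNeq]) (hker N hNρ)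
    rw [eq_of_ip_ne_zero hχ.1 (linear_mem_irr lam) hlam]
    simp
  exfalso
  obtain ⟨p, K, hp, hK, hNK, hKG, hcomm, hpow⟩ := hH.exists_step (R := commutator G) inferInstance
    hMN hlt
  obtain ⟨ν, hν, hνχ⟩ := exists_linTriv_ip_ne_zero (Subgroup.inclusion hNK.le)
    (Subgroup.inclusion_injective hNK.le) (commutator_le_range_inclusion hNK.le hcomm)
    (χ := fun k : K => χ k) (hker N hNρ)
  obtain ⟨g, -, hg2, hg3⟩ := hH.exists_fixedBy_conj (hMN.trans hNK.le) hχ (linear_mem_irr ν) hνχ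
  let ν' : K →* ℂˣ := ν.comp (MulAut.conjNormal g : K ≃* K).toMonoidHom
  have hν' : ∀ k : K, (k : G) ∈ N → ν' k = 1 := fun k hk => by
    obtain ⟨n, hn⟩ := (mem_range_inclusion hNK.le (MulAut.conjNormal g k)).2 (by
      rw [MulAut.conjNormal_apply]
      exact hNn.conj_mem k hk g)
    change ν (MulAut.conjNormal g k) = 1
    rw [← hn]
    exact hν n
  have hfix : ∀ h ∈ H, ∀ k, ν' (MulAut.conjNormal h k) = ν' k :=
    fun h hh k => Units.ext (hg2 h hh k)
  have hone : ν' = 1 := by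
    by_cases hpπ : p ∈ π
    · exact hH.linear_eq_one_of_mem ha hNK.le hKG hp hpow hpπ hχ ν' hν' hfix hg3
    · exact hH.linear_eq_one_of_notMem ha hMN hNK.le hKG hp hcomm hpow hpπ ν' hν' hfix
  have h1 : (fun k => ((ν' k : ℂˣ) : ℂ)) = 1 := by
    rw [hone]
    ext
    simp
  change ip (fun k : K => χ k) (fun k => ((ν' k : ℂˣ) : ℂ)) ≠ 0 at hg3
  rw [h1, hρχ] at hg3
  exact hNK.not_ge (hN.2 ⟨hK, hMN.trans hNK.le, hKG, eq_one_of_ip_ne_zero hρ hK hg3⟩ hNK.le)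

end IsHallModulo

end Converse

/-! ### Reduction to the solvable residual -/

section SolvableResidual

variable {G : Type*} [Group G]

/-- The solvable residual `M` is perfect, since `G ⧸ M'` is an extension of `G ⧸ M` by an abelian
group. -/
theorem solvableResidual_le_commutator_self [Finite G] :
    solvableResidual G ≤ ⁅solvableResidual G, solvableResidual G⁆ := by
  set M := solvableResidual G with hM
  obtain ⟨_, hsol⟩ := (isLeast_solvableResidual G).1
  refine (isLeast_solvableResidual G).2 ⟨inferInstance, ?_⟩
  have hle : ⁅M, M⁆ ≤ M := M.commutator_le_self
  let f : G ⧸ ⁅M, M⁆ →* G ⧸ M := QuotientGroup.map _ _ (MonoidHom.id G) hle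
  have hker : ∀ q ∈ f.ker, ∃ m ∈ M, (m : G ⧸ ⁅M, M⁆) = q := by
    intro q hq
    induction q using QuotientGroup.induction_on with
    | _ x => exact ⟨x, (QuotientGroup.eq_one_iff x).1 hq, rfl⟩
  have hcomm : ∀ a b : f.ker, a * b = b * a := by
    rintro ⟨a, ha⟩ ⟨b, hb⟩
    obtain ⟨m, hm, rfl⟩ := hker a ha
    obtain ⟨n, hn, rfl⟩ := hker b hb
    refine Subtype.ext ?_
    change ((m * n : G) : G ⧸ ⁅M, M⁆) = ((n * m : G) : G ⧸ ⁅M, M⁆)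
    rw [QuotientGroup.eq]
    have h1 := Subgroup.commutator_mem_commutator (inv_mem hn) (inv_mem hm)
    have h2 : (m * n)⁻¹ * (n * m) = ⁅n⁻¹, m⁻¹⁆ := by
      rw [commutatorElement_def]
      group
    rwa [h2]
  have := Group.isSolvable_of_comm hcomm
  exact Group.isSolvable_of_ker_le_range f.ker.subtype f (by rw [Subgroup.range_subtype])

theorem isHallModulo_solvableResidual [Finite G] {π : Set ℕ} (hπ : ∀ p ∈ π, p.Prime) {H : Subgroup G}
    (hMH : solvableResidual G ≤ H)
    (hH : IsHall π (H.map (QuotientGroup.mk' (solvableResidual G)))) :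
    IsHallModulo π (solvableResidual G) H where
  prime := hπ
  le := hMH
  solvable := (isLeast_solvableResidual G).1.2
  mem := by
    rw [← QuotientGroup.ker_mk' (solvableResidual G), Subgroup.relIndex_ker]
    exact hH.1
  notMem := by
    have h := hH.2
    rw [Subgroup.index_map, QuotientGroup.ker_mk', sup_eq_left.2 hMH,
      MonoidHom.range_eq_top.2 (QuotientGroup.mk'_surjective _), Subgroup.index_top, mul_one] at h
    exact h

/-- Normalizers and intersections in `G ⧸ M` can be computed in `G`. -/
theorem normalizer_map_inf_eq_iff {M H : Subgroup G} [M.Normal] (hM : M ≤ ⁅H, H⁆) :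
    Subgroup.normalizer (H.map (QuotientGroup.mk' M) : Set (G ⧸ M)) ⊓
        (commutator G).map (QuotientGroup.mk' M) = ⁅H, H⁆.map (QuotientGroup.mk' M) ↔
      ∀ x ∈ Subgroup.normalizer (H : Set G), x ∈ commutator G → x ∈ ⁅H, H⁆ := by
  have hsurj := QuotientGroup.mk'_surjective M
  have hcm : ∀ K : Subgroup G, M ≤ K →
      (K.map (QuotientGroup.mk' M)).comap (QuotientGroup.mk' M) = K := fun K hK =>
    Subgroup.comap_map_eq_self (by rwa [QuotientGroup.ker_mk'])
  have hHG : ⁅H, H⁆ ≤ commutator G := Subgroup.commutator_mono le_top le_top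
  have hHH : ⁅H, H⁆ ≤ H := H.commutator_le_self
  rw [← (Subgroup.comap_injective hsurj).eq_iff, Subgroup.comap_inf,
    Subgroup.comap_normalizer_eq_of_surjective _ hsurj, hcm _ hM, hcm _ (hM.trans hHG),
    hcm _ (hM.trans hHH)]
  refine ⟨fun h x hx hxG => h.le ⟨hx, hxG⟩, fun h => le_antisymm (fun x hx => h x hx.1 hx.2)
    (le_inf (hHH.trans Subgroup.le_normalizer) hHG)⟩

/-- The criterion for any perfect normal subgroup `M` with solvable quotient. -/
theorem irrPrime_eq_lin_iff [Finite G] {π : Set ℕ} {M H : Subgroup G} [M.Normal] (hM : M ≤ ⁅M, M⁆)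
    (hHall : IsHallModulo π M H) :
    IrrPrime π G = Lin G ↔
      (Subgroup.normalizer (H.map (QuotientGroup.mk' M) : Set (G ⧸ M)) ⊓
            (commutator G).map (QuotientGroup.mk' M) = ⁅H, H⁆.map (QuotientGroup.mk' M)) ∧
        {θ ∈ IrrPrime π M | FixedBy H M θ} = {1} := by
  have hMH' : M ≤ ⁅H, H⁆ := hM.trans (Subgroup.commutator_mono hHall.le hHall.le)
  rw [normalizer_map_inf_eq_iff hMH']
  constructor
  · refine fun hG => ⟨fun x hx hxG => hHall.mem_commutator_of_mem hG hMH'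
      (hHall.mem_of_mem_normalizer hG hx hxG) hxG, Set.Subset.antisymm ?_ ?_⟩
    · rintro θ ⟨hθ, hfix⟩
      obtain ⟨lam, hlam⟩ := exists_hom_of_apply_one hθ.1
        (hHall.apply_one_eq_one_of_fixedBy hG M le_rfl hθ hfix)
      refine funext fun m => ?_
      -- a linear character of the perfect group `M` is trivial
      have hm := hM m.2
      rw [← Subgroup.map_subtype_commutator] at hm
      obtain ⟨y, hy, hym⟩ := hm
      rw [hlam, ← Subtype.ext hym]
      simpa using Abelianization.commutator_subset_ker lam hy
    · rintro _ rfl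
      refine ⟨?_, fun _ _ _ => rfl⟩
      have h := linear_mem_irrPrime hHall.prime (1 : M →* ℂˣ)
      simp only [MonoidHom.one_apply, Units.val_one] at h
      exact h
  · rintro ⟨ha, hb⟩
    refine Set.Subset.antisymm (fun χ hχ => ⟨hχ.1, ?_⟩) fun χ hχ => ?_
    · exact hHall.apply_one_eq_one (hMH'.trans (Subgroup.commutator_mono le_top le_top)) ha
        (fun θ hθ hfix => hb.le ⟨hθ, hfix⟩) hχ
    · exact ⟨hχ.1, 1, by rw [hχ.2, Nat.cast_one],
        fun p hp h => (hHall.prime p hp).one_lt.ne' (Nat.dvd_one.1 h)⟩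

end SolvableResidual

end PiPrimeChar

theorem theorem4p2 {G : Type*} [Group G] [Finite G] (π : Set ℕ) (hπ : ∀ p ∈ π, p.Prime)
    (H : Subgroup G) (hMH : PiPrimeChar.solvableResidual G ≤ H)
    (hH : PiPrimeChar.IsHall π (H.map (QuotientGroup.mk' (PiPrimeChar.solvableResidual G)))) :
    PiPrimeChar.IrrPrime π G = PiPrimeChar.Lin G ↔
      (Subgroup.normalizer (H.map (QuotientGroup.mk' (PiPrimeChar.solvableResidual G)) :
              Set (G ⧸ PiPrimeChar.solvableResidual G)) ⊓
            (commutator G).map (QuotientGroup.mk' (PiPrimeChar.solvableResidual G)) =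
          (⁅H, H⁆ : Subgroup G).map (QuotientGroup.mk' (PiPrimeChar.solvableResidual G))) ∧
        {θ ∈ PiPrimeChar.IrrPrime π (PiPrimeChar.solvableResidual G) |
          PiPrimeChar.FixedBy H (PiPrimeChar.solvableResidual G) θ} = {1} := by
  exact PiPrimeChar.irrPrime_eq_lin_iff PiPrimeChar.solvableResidual_le_commutator_self
    (PiPrimeChar.isHallModulo_solvableResidual hπ hMH hH)
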